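/- **Setting.** Let $0\le k\le n$ and let $G_1,\dots,G_{n-k}$ be independent, pairwise commuting, Hermitian elements of the $n$-qubit Pauli group generating a group $\mathscr S_0\not\ni -\mathbb 1$. Let $\mathcal Q_0=\{|\psi\rangle: S|\psi\rangle=|\psi\rangle\ \forall S\in\mathscr S_0\}$ be the corresponding stabilizer code $[[n,k]]$. Let $t_1,\dots,t_K$ be $n$-qubit Pauli operators lying in pairwise different cosets of the normalizer of $\mathscr S_0$ in the Pauli group. The union stabilizer (USt) code with this translation set is $\mathcal Q=\bigoplus_{i=1}^K t_i(\mathcal Q_0)$; it has length $n$ and dimension $K\,2^k$. It is $t$-error correcting if for all Pauli operators $E_1,E_2$ of weight at most $t$ there is a constant $C_{E_1,E_2}$ with $\langle\varphi|E_1^\dagger E_2|\psi\rangle=C_{E_1,E_2}\langle\varphi|\psi\rangle$ for all $\varphi,\psi\in\mathcal Q$. A *measurement* is the two-outcome projective measurement of an observable $M=M^\dagger$ with $M^2=\mathbb 1$. It is carried out by a circuit of arbitrary one- and two-qubit unitary gates on the $n$ qubits and some ancillas initialized in $|0\rangle$, which maps $|\psi\rangle|0\rangle|0\cdots0\rangle$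 to $P_M|\psi\rangle|0\rangle|0\cdots0\rangle+(\mathbb 1-P_M)|\psi\rangle|1\rangle|0\cdots0\rangle$, where $P_M=(\mathbb 1+M)/2$; the first ancilla is then read out. Its *(two-qubit) complexity* is the number of two-qubit gates in the circuit. **Theorem.** Let $\mathcal Q$ be any $t$-error correcting USt code of length $n$ and dimension $K\,2^k$, with a translation set of size $K$ (where $t=0$ if $n=1$). Then $\mathcal Q$ can correct all Pauli errors of weight at most $t$ using $\binom{n}{t}+2t-1$ or fewer measurements, each of which has two-qubit complexity $2K(n+1)(n-k-1)$ or less. That is, there is an adaptive procedure which performs at most $\binom nt+2t-1$ such measurements, the choice of each depending on the previous outcomes, followed by a Pauli operator depending on the outcomes, and which restores every state $|\psi\rangle\in\mathcal Q$, up to a scalar independent of $|\psi\rangle$, after any Pauli error of weight at most $t$, whatever the measurement outcomes are. -/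

import Mathlib

open scoped Matrix

namespace QECC

/-! ### Qubits and Pauli operators -/

/-- Computational basis labels of a register whose qubits are indexed by `ι`. -/
abbrev Bits (ι : Type) : Type := ι → Fin 2

/-- Vectors of the Hilbert space `(ℂ²)^{⊗ι}`, given by their amplitudes. -/
abbrev Vec (ι : Type) : Type := Bits ι → ℂ

/-- Operators on the Hilbert space `(ℂ²)^{⊗ι}`. -/
abbrev Op (ι : Type) : Type := Matrix (Bits ι) (Bits ι) ℂ

/-- The four single-qubit Pauli labels. -/
inductive Pauli : Type
  | I | X | Y | Z
  deriving DecidableEq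

/-- The single-qubit Pauli matrices. -/
def Pauli.mat : Pauli → Matrix (Fin 2) (Fin 2) ℂ
  | .I => !![1, 0; 0, 1]
  | .X => !![0, 1; 1, 0]
  | .Y => !![0, -Complex.I; Complex.I, 0]
  | .Z => !![1, 0; 0, -1]

/-- The tensor product of the single-qubit Pauli matrices `p q`, one for each qubit `q`. -/
def pauliOp {n : ℕ} (p : Fin n → Pauli) : Op (Fin n) :=
  Matrix.of fun x y => ∏ q, (p q).mat (x q) (y q)

/-- The number of qubits on which a Pauli string is not the identity. -/
def weight {n : ℕ} (p : Fin n → Pauli) : ℕ :=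
  (Finset.univ.filter fun q => p q ≠ Pauli.I).card

/-- Membership in the Pauli group `{i^m P : m = 0, …, 3, P ∈ {I,X,Y,Z}^{⊗n}}`. -/
def IsPauli {n : ℕ} (U : Op (Fin n)) : Prop :=
  ∃ (m : Fin 4) (p : Fin n → Pauli), U = Complex.I ^ (m : ℕ) • pauliOp p

/-- The Pauli errors of weight at most `t` (with an arbitrary phase `i^m`). -/
def pauliErrors (n t : ℕ) : Set (Op (Fin n)) :=
  {E | ∃ (m : Fin 4) (p : Fin n → Pauli),
    weight p ≤ t ∧ E = Complex.I ^ (m : ℕ) • pauliOp p}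

/-! ### Stabilizer codes, union stabilizer codes, error correction -/

/-- The group generated by the operators `G i`.  It is used for Hermitian Pauli operators, which
are involutions, so that the generated monoid is the generated group. -/
def generated {n r : ℕ} (G : Fin r → Op (Fin n)) : Submonoid (Op (Fin n)) :=
  Submonoid.closure (Set.range G)

/-- `G` is a list of independent, commuting, Hermitian Pauli operators that generate a group
not containing `-1`. -/
structure IsStabilizerGenerators {n r : ℕ} (G : Fin r → Op (Fin n)) : Prop where
  pauli : ∀ i, IsPauli (G i)
  hermitian : ∀ i, (G i).IsHermitian
  commute : ∀ i j, Commute (G i) (G j)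
  independent : ∀ i, G i ∉ Submonoid.closure (G '' {j | j ≠ i})
  neg_one_notMem : (-1 : Op (Fin n)) ∉ generated G

/-- The space of all vectors that are fixed by the group generated by `G`. -/
def stabilizedSpace {n r : ℕ} (G : Fin r → Op (Fin n)) : Submodule ℂ (Vec (Fin n)) where
  carrier := {ψ | ∀ S ∈ generated G, S *ᵥ ψ = ψ}
  add_mem' := by
    intro a b ha hb S hS
    rw [Matrix.mulVec_add, ha S hS, hb S hS]
  zero_mem' := by
    intro S _
    exact Matrix.mulVec_zero S
  smul_mem' := by
    intro c a ha S hS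
    rw [Matrix.mulVec_smul, ha S hS]

/-- The normalizer, in the Pauli group, of the group generated by `G`: the Pauli operators `U`
with `U† S U = S` for all group elements `S`. -/
def normalizer {n r : ℕ} (G : Fin r → Op (Fin n)) : Set (Op (Fin n)) :=
  {U | IsPauli U ∧ ∀ S ∈ generated G, Uᴴ * S * U = S}

/-- The data of a union stabilizer code: `n - k` stabilizer generators of an originating
stabilizer code `[[n,k]]` and `K` Pauli translations, which are pairwise inequivalent, that is,
lie in different cosets of the normalizer. -/
structure UStCode (n k K : ℕ) where
  k_le_n : k ≤ n
  gen : Fin (n - k) → Op (Fin n)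
  isStabilizerGenerators : IsStabilizerGenerators gen
  translation : Fin K → Op (Fin n)
  translation_pauli : ∀ j, IsPauli (translation j)
  inequivalent : ∀ i j, i ≠ j → (translation i)ᴴ * translation j ∉ normalizer gen

/-- The code space: the sum of the `K` shifts of the originating stabilizer code. -/
def UStCode.space {n k K : ℕ} (C : UStCode n k K) : Submodule ℂ (Vec (Fin n)) :=
  ⨆ j : Fin K, (stabilizedSpace C.gen).map (Matrix.toLin' (C.translation j))

/-- The (Knill–Laflamme) error correction condition for all Pauli errors of weight at most `t`:
`⟨φ|E₁† E₂|ψ⟩ = c ⟨φ|ψ⟩` for all `φ, ψ` in the code, with `c` depending on `E₁, E₂` only. -/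
def IsErrorCorrecting {n : ℕ} (t : ℕ) (Q : Submodule ℂ (Vec (Fin n))) : Prop :=
  ∀ E₁ ∈ pauliErrors n t, ∀ E₂ ∈ pauliErrors n t, ∃ c : ℂ,
    ∀ φ ∈ Q, ∀ ψ ∈ Q, star φ ⬝ᵥ ((E₁ᴴ * E₂) *ᵥ ψ) = c * (star φ ⬝ᵥ ψ)

/-! ### Circuits -/

/-- Gates on a register: arbitrary unitaries on one qubit or on two distinct qubits. -/
inductive Gate (ι : Type) : Type
  | one (i : ι) (V : Matrix.unitaryGroup (Fin 2) ℂ) : Gate ι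
  | two (i j : ι) (hij : i ≠ j) (V : Matrix.unitaryGroup (Fin 2 × Fin 2) ℂ) : Gate ι

open scoped Classical in
/-- The operator of a gate on the whole register (identity on all other qubits). -/
noncomputable def Gate.op {ι : Type} : Gate ι → Op ι
  | .one i V => Matrix.of fun x y =>
      if ∀ l, l ≠ i → x l = y l then V.1 (x i) (y i) else 0
  | .two i j _ V => Matrix.of fun x y =>
      if ∀ l, l ≠ i → l ≠ j → x l = y l then V.1 (x i, x j) (y i, y j) else 0

/-- A gate counts one if it is a two-qubit gate, zero otherwise. -/
def Gate.cost {ι : Type} : Gate ι → ℕ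
  | .one _ _ => 0
  | .two _ _ _ _ => 1

/-- The operator of a circuit; the head of the list is the gate that is applied first. -/
noncomputable def circuitOp {ι : Type} [Fintype ι] [DecidableEq ι] : List (Gate ι) → Op ι
  | [] => 1
  | g :: gs => circuitOp gs * g.op

/-- The two-qubit complexity of a circuit: the number of its two-qubit gates. -/
def twoQubitCount {ι : Type} (gs : List (Gate ι)) : ℕ := (gs.map Gate.cost).sum

/-- The state `|ψ⟩ ⊗ |z⟩`, with the ancillas in the computational basis state `z`. -/
def withAncillas {n a : ℕ} (ψ : Vec (Fin n)) (z : Bits (Fin a)) : Vec (Fin n ⊕ Fin a) :=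
  fun x => if x ∘ Sum.inr = z then ψ (x ∘ Sum.inl) else 0

/-! ### Measurements and recovery procedures -/

/-- A measurement of an `n`-qubit observable `M` that is Hermitian and unitary, realized by a
circuit on the `n` qubits and `a + 1` ancillas prepared in `|0⟩`.  The circuit maps
`|ψ⟩|0⟩|0…0⟩` to `P|ψ⟩|0⟩|0…0⟩ + (1 - P)|ψ⟩|1⟩|0…0⟩`, where `P = (1 + M)/2` projects onto the
`+1` eigenspace of `M`; afterwards ancilla number `0` is read out in the computational basis. -/
structure Measurement (n : ℕ) where
  M : Op (Fin n)
  hermitian : M.IsHermitian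
  unitary : M * M = 1
  a : ℕ
  circuit : List (Gate (Fin n ⊕ Fin (a + 1)))
  realizes : ∀ ψ : Vec (Fin n),
    circuitOp circuit *ᵥ withAncillas ψ (0 : Bits (Fin (a + 1))) =
      withAncillas (((1 / 2 : ℂ) • (1 + M)) *ᵥ ψ) (0 : Bits (Fin (a + 1))) +
      withAncillas (((1 / 2 : ℂ) • (1 - M)) *ᵥ ψ) (Pi.single 0 1 : Bits (Fin (a + 1)))

/-- The projection onto the `+1` eigenspace of the observable. -/
noncomputable def Measurement.plus {n : ℕ} (m : Measurement n) : Op (Fin n) :=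
  (1 / 2 : ℂ) • (1 + m.M)

/-- The projection onto the `-1` eigenspace of the observable. -/
noncomputable def Measurement.minus {n : ℕ} (m : Measurement n) : Op (Fin n) :=
  (1 / 2 : ℂ) • (1 - m.M)

/-- Adaptive recovery procedures: either stop and apply a Pauli operator, or perform a
measurement and continue in a way that depends on its outcome. -/
inductive Recovery (n : ℕ) : Type
  | correct (p : Fin n → Pauli) : Recovery n
  | measure (m : Measurement n) (ifPlus ifMinus : Recovery n) : Recovery n

/-- The largest number of measurements performed on any branch. -/
def Recovery.depth {n : ℕ} : Recovery n → ℕ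
  | .correct _ => 0
  | .measure _ r s => max r.depth s.depth + 1

/-- All measurements that occur in the procedure. -/
def Recovery.measurements {n : ℕ} : Recovery n → List (Measurement n)
  | .correct _ => []
  | .measure m r s => m :: (r.measurements ++ s.measurements)

/-- The operators applied to the (unnormalized) state on the branches of the procedure, one for
each sequence of measurement outcomes: eigenspace projections followed by a Pauli operator. -/
noncomputable def Recovery.branches {n : ℕ} : Recovery n → List (Op (Fin n))
  | .correct p => [pauliOp p]
  | .measure m r s =>
      r.branches.map (fun B => B * m.plus) ++ s.branches.map (fun B => B * m.minus)

/-- The procedure corrects all Pauli errors of weight at most `t` on the code `Q`: whatever the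
measurement outcomes are, every code state is restored up to a scalar (which is zero for
outcomes of probability zero). -/
def Recovery.Corrects {n : ℕ} (r : Recovery n) (t : ℕ) (Q : Submodule ℂ (Vec (Fin n))) : Prop :=
  ∀ E ∈ pauliErrors n t, ∀ B ∈ r.branches, ∃ c : ℂ, ∀ ψ ∈ Q, B *ᵥ (E *ᵥ ψ) = c • ψ

end QECC

/-!
Let `V = (ℤ/2)^(n-k)`. The joint eigenspaces of the stabilizer generators are indexed by syndromes
`s ∈ V`, a Pauli operator `E` moves the eigenspace of `s` to that of `s + σ(E)`, and the code is the
sum of the eigenspaces for the distinct syndromes `σ_j` of the translations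
(`UStCode.exists_strings`). Every measurement used here is of an observable `(-1)^f`, where `f` is a
Boolean function of the syndrome (`syndromeObservable`), and it suffices that its circuit computes
`f` into an ancilla on states of definite syndrome (`exists_measurement`).

If correctable errors `E`, `E'` map some components of the code to the same eigenspace,
`σ(E) + σ_j = σ(E') + σ_i`, then the constant in the error correction condition for `E'† E` has
modulus one, so that `E` and `E'` agree on the code up to a scalar, and `i = j`
(`IsShiftedCode.sameAction_of_syndrome`). For a set `A` of `t` qubits let `L` be the group of the
syndromes of the errors supported on `A` (`localSyndromes`). The cosets `σ_j + L` are distinct, and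
a correctable error either is equivalent to one supported on `A`, or leads to syndromes outside of
these cosets. So the measurement of `f(s) = ∑_j [s ∈ σ_j + L]` finds out which is the case, and
`binom(n, t) - 1` of them determine a suitable `A`. Then the coset of `s` determines `j`,
and for each linear form `λ` the function `f(s) = λ(s) + ∑_j λ(σ_j) [s ∈ σ_j + L]` has the value
`λ(σ(E))`; as `dim L ≤ 2t`, at most `2t` forms identify the error.

The circuits write the `ρ = dim V/L` forms that define `L` into ancillas, with `n` controlled Pauli
gates each, add an AND of `ρ` conditions to the target for each `j`, with a chain of Toffoli gates
of five two-qubit gates each, uncompute the forms, and add `λ` to the target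
(`exists_pattern_measurement`). As `L ≠ 0` by error correction, `ρ ≤ n - k - 1`, and for `K ≥ 2` the
count stays below the bound (`cost_le`). For `K = 1` the generators themselves are measured; here
error correction implies `n - k ≥ 2` (`IsShiftedCode.two_le_generators`).
-/

namespace QECC

section Algebra

/-! ### Signs and tensor products of single-qubit matrices -/

/-- The sign `(-1)^x` of a bit. -/
def sgn (x : ZMod 2) : ℂ := if x = 0 then 1 else -1

lemma zmod_two_cases (x : ZMod 2) : x = 0 ∨ x = 1 := by
  revert x; decide

lemma sgn_zero : sgn 0 = 1 := by simp [sgn]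

lemma sgn_one : sgn 1 = -1 := by simp [sgn]

lemma sgn_add (x y : ZMod 2) : sgn (x + y) = sgn x * sgn y := by
  rcases zmod_two_cases x with rfl | rfl <;> rcases zmod_two_cases y with rfl | rfl <;>
    simp [sgn_zero, sgn_one, CharTwo.add_self_eq_zero]

lemma sgn_sum {ι : Type*} (s : Finset ι) (f : ι → ZMod 2) :
    sgn (∑ i ∈ s, f i) = ∏ i ∈ s, sgn (f i) := by
  classical
  induction s using Finset.induction_on with
  | empty => simp [sgn_zero]
  | insert a s ha ih => rw [Finset.sum_insert ha, Finset.prod_insert ha, sgn_add, ih]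

lemma sgn_mul_self (x : ZMod 2) : sgn x * sgn x = 1 := by
  rw [← sgn_add, CharTwo.add_self_eq_zero, sgn_zero]

lemma star_sgn (x : ZMod 2) : star (sgn x) = sgn x := by
  rcases zmod_two_cases x with rfl | rfl <;> simp [sgn_zero, sgn_one]

lemma sgn_injective : Function.Injective sgn := by
  intro x y h
  rcases zmod_two_cases x with rfl | rfl <;> rcases zmod_two_cases y with rfl | rfl
  · rfl
  · norm_num [sgn_zero, sgn_one] at h
  · norm_num [sgn_zero, sgn_one] at h
  · rfl

/-- The tensor product of the single-qubit operators `m q`, one for each qubit `q`. -/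
def tensor {n : ℕ} (m : Fin n → Matrix (Fin 2) (Fin 2) ℂ) : Op (Fin n) :=
  Matrix.of fun x y => ∏ q, m q (x q) (y q)

variable {n : ℕ}

lemma tensor_mul (m m' : Fin n → Matrix (Fin 2) (Fin 2) ℂ) :
    tensor m * tensor m' = tensor (m * m') := by
  ext x y
  simp only [tensor, Matrix.mul_apply, Matrix.of_apply, Pi.mul_apply, ← Finset.prod_mul_distrib]
  rw [Finset.prod_univ_sum, Fintype.piFinset_univ]

lemma tensor_one : tensor (1 : Fin n → Matrix (Fin 2) (Fin 2) ℂ) = 1 := by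
  ext x y
  simp only [tensor, Matrix.of_apply, Pi.one_apply, Matrix.one_apply]
  rw [Finset.prod_ite_zero]
  simp [funext_iff]

lemma tensor_smul (c : Fin n → ℂ) (m : Fin n → Matrix (Fin 2) (Fin 2) ℂ) :
    tensor (fun q => c q • m q) = (∏ q, c q) • tensor m := by
  ext x y
  simp [tensor, Finset.prod_mul_distrib]

lemma tensor_conjTranspose (m : Fin n → Matrix (Fin 2) (Fin 2) ℂ) :
    (tensor m)ᴴ = tensor (fun q => (m q)ᴴ) := by
  ext x y
  simp [tensor, Matrix.conjTranspose_apply]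

/-! ### The Pauli group and its symplectic form -/

/-- The symplectic description of a Pauli label: `X^a Z^b` up to a phase corresponds to
`(a, b)`. -/
def Pauli.bits : Pauli → ZMod 2 × ZMod 2
  | .I => (0, 0)
  | .X => (1, 0)
  | .Y => (1, 1)
  | .Z => (0, 1)

/-- The Pauli label with the given symplectic description. -/
def Pauli.ofBits (b : ZMod 2 × ZMod 2) : Pauli :=
  if b.1 = 0 then (if b.2 = 0 then .I else .Z) else (if b.2 = 0 then .X else .Y)

lemma Pauli.bits_ofBits (b : ZMod 2 × ZMod 2) : (Pauli.ofBits b).bits = b := by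
  revert b; decide

lemma Pauli.ofBits_zero : Pauli.ofBits 0 = .I := by decide

/-- The symplectic form: two Pauli matrices commute if it vanishes and anticommute
otherwise. -/
def Pauli.form (a : Pauli) : (ZMod 2 × ZMod 2) →ₗ[ZMod 2] ZMod 2 :=
  a.bits.1 • LinearMap.snd (ZMod 2) (ZMod 2) (ZMod 2) +
    a.bits.2 • LinearMap.fst (ZMod 2) (ZMod 2) (ZMod 2)

lemma Pauli.form_apply (a : Pauli) (b : ZMod 2 × ZMod 2) :
    a.form b = a.bits.1 * b.2 + a.bits.2 * b.1 := by
  simp [Pauli.form]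

lemma Pauli.mat_mul_comm (a b : Pauli) :
    a.mat * b.mat = sgn (a.form b.bits) • (b.mat * a.mat) := by
  cases a <;> cases b <;>
    simp [Pauli.mat, Pauli.form_apply, Pauli.bits, sgn, Matrix.one_fin_two.symm,
      CharTwo.add_self_eq_zero]

lemma Pauli.mat_mul_self (a : Pauli) : a.mat * a.mat = 1 := by
  cases a <;> simp [Pauli.mat, Matrix.one_fin_two]

lemma Pauli.mat_conjTranspose (a : Pauli) : a.matᴴ = a.mat := by
  cases a <;> ext i j <;> fin_cases i <;> fin_cases j <;>
    simp [Pauli.mat, Matrix.conjTranspose_apply]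

lemma Pauli.mat_mul (a b : Pauli) : ∃ (m : ℕ) (c : Pauli),
    a.mat * b.mat = Complex.I ^ m • c.mat := by
  cases a <;> cases b
  case I.I => exact ⟨0, .I, by simp [Pauli.mat]⟩
  case I.X => exact ⟨0, .X, by simp [Pauli.mat]⟩
  case I.Y => exact ⟨0, .Y, by simp [Pauli.mat]⟩
  case I.Z => exact ⟨0, .Z, by simp [Pauli.mat]⟩
  case X.I => exact ⟨0, .X, by simp [Pauli.mat]⟩
  case X.X => exact ⟨0, .I, by simp [Pauli.mat]⟩
  case X.Y => exact ⟨1, .Z, by simp [Pauli.mat]⟩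
  case X.Z => exact ⟨3, .Y, by simp [Pauli.mat, pow_succ]⟩
  case Y.I => exact ⟨0, .Y, by simp [Pauli.mat]⟩
  case Y.X => exact ⟨3, .Z, by simp [Pauli.mat, pow_succ]⟩
  case Y.Y => exact ⟨0, .I, by simp [Pauli.mat]⟩
  case Y.Z => exact ⟨1, .X, by simp [Pauli.mat]⟩
  case Z.I => exact ⟨0, .Z, by simp [Pauli.mat]⟩
  case Z.X => exact ⟨1, .Y, by simp [Pauli.mat]⟩
  case Z.Y => exact ⟨3, .X, by simp [Pauli.mat, pow_succ]⟩
  case Z.Z => exact ⟨0, .I, by simp [Pauli.mat]⟩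

lemma pauliOp_eq_tensor (p : Fin n → Pauli) : pauliOp p = tensor fun q => (p q).mat := rfl

lemma pauliOp_mul_self (p : Fin n → Pauli) : pauliOp p * pauliOp p = 1 := by
  rw [pauliOp_eq_tensor, tensor_mul, ← tensor_one]
  congr 1
  funext q
  exact Pauli.mat_mul_self _

lemma pauliOp_conjTranspose (p : Fin n → Pauli) : (pauliOp p)ᴴ = pauliOp p := by
  rw [pauliOp_eq_tensor, tensor_conjTranspose]
  congr 1
  funext q
  exact Pauli.mat_conjTranspose _

lemma pauliOp_identity : pauliOp (fun _ : Fin n => Pauli.I) = 1 := by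
  rw [pauliOp_eq_tensor, ← tensor_one]
  congr 1
  funext q
  simp [Pauli.mat, Matrix.one_fin_two]

/-- The symplectic form of two Pauli strings. -/
def stringForm (p : Fin n → Pauli) : (Fin n → ZMod 2 × ZMod 2) →ₗ[ZMod 2] ZMod 2 :=
  ∑ q, (p q).form ∘ₗ LinearMap.proj q

lemma stringForm_apply (p : Fin n → Pauli) (u : Fin n → ZMod 2 × ZMod 2) :
    stringForm p u = ∑ q, (p q).form (u q) := by
  simp [stringForm]

lemma pauliOp_mul_comm (p u : Fin n → Pauli) :
    pauliOp p * pauliOp u =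
      sgn (stringForm p fun q => (u q).bits) • (pauliOp u * pauliOp p) := by
  rw [pauliOp_eq_tensor, pauliOp_eq_tensor, tensor_mul, tensor_mul, stringForm_apply, sgn_sum,
    ← tensor_smul]
  congr 1
  funext q
  exact Pauli.mat_mul_comm _ _

lemma pauliOp_mul (p u : Fin n → Pauli) : ∃ (m : ℕ) (v : Fin n → Pauli),
    pauliOp p * pauliOp u = Complex.I ^ m • pauliOp v := by
  choose m v h using fun q => Pauli.mat_mul (p q) (u q)
  refine ⟨∑ q, m q, v, ?_⟩
  rw [← Finset.prod_pow_eq_pow_sum, pauliOp_eq_tensor, pauliOp_eq_tensor, pauliOp_eq_tensor,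
    tensor_mul, ← tensor_smul]
  congr 1
  funext q
  exact h q

lemma isPauli_iff {U : Op (Fin n)} :
    IsPauli U ↔ ∃ (m : ℕ) (p : Fin n → Pauli), U = Complex.I ^ m • pauliOp p := by
  constructor
  · rintro ⟨m, p, h⟩
    exact ⟨m, p, h⟩
  · rintro ⟨m, p, h⟩
    refine ⟨⟨m % 4, Nat.mod_lt _ (by norm_num)⟩, p, ?_⟩
    rw [h]
    congr 1
    exact Complex.I_pow_eq_pow_mod m

lemma IsPauli.mul {U W : Op (Fin n)} (hU : IsPauli U) (hW : IsPauli W) : IsPauli (U * W) := by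
  obtain ⟨a, p, rfl⟩ := isPauli_iff.1 hU
  obtain ⟨b, u, rfl⟩ := isPauli_iff.1 hW
  obtain ⟨c, v, h⟩ := pauliOp_mul p u
  refine isPauli_iff.2 ⟨a + b + c, v, ?_⟩
  rw [Matrix.smul_mul, Matrix.mul_smul, h, smul_smul, smul_smul, pow_add, pow_add, mul_assoc]

lemma IsPauli.one : IsPauli (1 : Op (Fin n)) :=
  isPauli_iff.2 ⟨0, fun _ => .I, by rw [pauliOp_identity, pow_zero, one_smul]⟩

lemma star_I_pow_mul (m : ℕ) : star (Complex.I ^ m) * Complex.I ^ m = 1 := by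
  simp [← mul_pow]

lemma IsPauli.conjTranspose {U : Op (Fin n)} (hU : IsPauli U) : IsPauli Uᴴ := by
  obtain ⟨a, p, rfl⟩ := isPauli_iff.1 hU
  refine isPauli_iff.2 ⟨3 * a, p, ?_⟩
  rw [Matrix.conjTranspose_smul, pauliOp_conjTranspose, pow_mul]
  simp [pow_succ]

lemma IsPauli.conjTranspose_mul_self {U : Op (Fin n)} (hU : IsPauli U) : Uᴴ * U = 1 := by
  obtain ⟨a, p, rfl⟩ := isPauli_iff.1 hU
  rw [Matrix.conjTranspose_smul, pauliOp_conjTranspose, Matrix.smul_mul, Matrix.mul_smul,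
    smul_smul, pauliOp_mul_self, star_I_pow_mul, one_smul]

end Algebra

/-! ### The action of gates and circuits on vectors -/

section Gates

variable {ι : Type} [DecidableEq ι]

/-- The action on a vector of the matrix `U`, applied to the qubit `i`. -/
def act (i : ι) (U : Matrix (Fin 2) (Fin 2) ℂ) (Ψ : Vec ι) : Vec ι :=
  fun x => ∑ u, U (x i) u * Ψ (Function.update x i u)

/-- The two-qubit gate that applies `U` to the qubit `t` if the qubit `c` has the value `α`. -/
def controlled (c : ι) (α : Fin 2) (t : ι) (h : t ≠ c) (U : Matrix.unitaryGroup (Fin 2) ℂ) :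
    Gate ι :=
  .two t c h ⟨Matrix.blockDiagonal fun k => if k = α then (U : Matrix (Fin 2) (Fin 2) ℂ) else 1,
    by
      rw [Matrix.mem_unitaryGroup_iff, Matrix.star_eq_conjTranspose,
        Matrix.blockDiagonal_conjTranspose, ← Matrix.blockDiagonal_mul,
        ← Matrix.blockDiagonal_one]
      congr 1
      funext k
      split_ifs
      · exact Matrix.mem_unitaryGroup_iff.1 U.2
      · simp⟩

variable [Fintype ι]

lemma one_mulVec (i : ι) (V : Matrix.unitaryGroup (Fin 2) ℂ) (Ψ : Vec ι) :
    (Gate.one i V).op *ᵥ Ψ = act i V.1 Ψ := by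
  funext x
  symm
  refine Fintype.sum_of_injective (fun u => Function.update x i u)
    (Function.update_injective x i) _ _ ?_ ?_
  · intro y hy
    have : ¬ ∀ l, l ≠ i → x l = y l := by
      intro h
      refine hy ⟨y i, ?_⟩
      funext l
      by_cases hl : l = i
      · subst hl; simp
      · simp [Function.update_of_ne hl, h l hl]
    simp [Gate.op, this]
  · intro u
    have : ∀ l, l ≠ i → x l = Function.update x i u l := fun l hl => by
      simp [Function.update_of_ne hl]
    simp only [Gate.op, Matrix.of_apply]
    rw [if_pos this]
    simp

lemma controlled_mulVec (c : ι) (α : Fin 2) (t : ι) (h : t ≠ c)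
    (U : Matrix.unitaryGroup (Fin 2) ℂ) (Ψ : Vec ι) :
    (controlled c α t h U).op *ᵥ Ψ = fun x => if x c = α then act t U.1 Ψ x else Ψ x := by
  funext x
  have key : ((controlled c α t h U).op *ᵥ Ψ) x =
      ∑ u, (if x c = α then U.1 else 1) (x t) u * Ψ (Function.update x t u) := by
    symm
    refine Fintype.sum_of_injective (fun u => Function.update x t u)
      (Function.update_injective x t) _ _ ?_ ?_
    · intro y hy
      simp only [controlled, Gate.op, Matrix.of_apply]
      split_ifs with h1
      · rw [Matrix.blockDiagonal_apply, if_neg, zero_mul]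
        intro h2
        refine hy ⟨y t, ?_⟩
        funext l
        by_cases hl : l = t
        · subst hl; simp
        · by_cases hc : l = c
          · subst hc; simpa [Function.update_of_ne hl] using h2
          · simp [Function.update_of_ne hl, h1 l hl hc]
      · simp
    · intro u
      have : ∀ l, l ≠ t → l ≠ c → x l = Function.update x t u l := fun l hl _ => by
        simp [Function.update_of_ne hl]
      simp only [controlled, Gate.op, Matrix.of_apply]
      rw [if_pos this, Matrix.blockDiagonal_apply]
      simp [Function.update_of_ne h.symm]
  rw [key]
  split_ifs
  · rfl
  · simp [Matrix.one_apply]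

/-- The action of a circuit on a vector. -/
noncomputable def run (l : List (Gate ι)) (Ψ : Vec ι) : Vec ι := circuitOp l *ᵥ Ψ

lemma run_nil (Ψ : Vec ι) : run [] Ψ = Ψ := by simp [run, circuitOp]

lemma run_cons (g : Gate ι) (l : List (Gate ι)) (Ψ : Vec ι) :
    run (g :: l) Ψ = run l (g.op *ᵥ Ψ) := by
  simp [run, circuitOp]

lemma run_append (l l' : List (Gate ι)) (Ψ : Vec ι) :
    run (l ++ l') Ψ = run l' (run l Ψ) := by
  induction l generalizing Ψ with
  | nil => rw [run_nil, List.nil_append]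
  | cons g l ih => rw [List.cons_append, run_cons, run_cons, ih]

lemma run_add (l : List (Gate ι)) (Ψ Φ : Vec ι) : run l (Ψ + Φ) = run l Ψ + run l Φ :=
  Matrix.mulVec_add _ _ _

lemma run_smul (l : List (Gate ι)) (c : ℂ) (Ψ : Vec ι) : run l (c • Ψ) = c • run l Ψ :=
  Matrix.mulVec_smul _ _ _

end Gates

lemma twoQubitCount_append {ι : Type} (l l' : List (Gate ι)) :
    twoQubitCount (l ++ l') = twoQubitCount l + twoQubitCount l' := by
  simp [twoQubitCount]

/-! ### Gates on a register with ancillas -/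

section Ancillas

variable {n a : ℕ}

lemma withAncillas_add (ψ φ : Vec (Fin n)) (z : Bits (Fin a)) :
    withAncillas (ψ + φ) z = withAncillas ψ z + withAncillas φ z := by
  funext x
  simp only [withAncillas, Pi.add_apply]
  split_ifs <;> simp

lemma withAncillas_smul (c : ℂ) (ψ : Vec (Fin n)) (z : Bits (Fin a)) :
    withAncillas (c • ψ) z = c • withAncillas ψ z := by
  funext x
  simp only [withAncillas, Pi.smul_apply]
  split_ifs <;> simp

lemma act_inl_withAncillas (q : Fin n) (U : Matrix (Fin 2) (Fin 2) ℂ) (ψ : Vec (Fin n))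
    (z : Bits (Fin a)) : act (Sum.inl q) U (withAncillas ψ z) = withAncillas (act q U ψ) z := by
  funext x
  have h1 : ∀ u, Function.update x (Sum.inl q) u ∘ (Sum.inr : Fin a → Fin n ⊕ Fin a)
      = x ∘ Sum.inr := by
    intro u; funext k; simp
  have h2 : ∀ u, Function.update x (Sum.inl q) u ∘ (Sum.inl : Fin n → Fin n ⊕ Fin a)
      = Function.update (x ∘ Sum.inl) q u := by
    intro u; exact Function.update_comp_eq_of_injective _ Sum.inl_injective _ _
  simp only [act, withAncillas, h1, h2]
  split_ifs <;> simp

/-- The state `|ψ⟩ ⊗ U_k|z⟩`, where `U` acts on the ancilla `k`. -/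
noncomputable def rotated (k : Fin a) (U : Matrix (Fin 2) (Fin 2) ℂ) (ψ : Vec (Fin n))
    (z : Bits (Fin a)) : Vec (Fin n ⊕ Fin a) :=
  ∑ u : Fin 2, U u (z k) • withAncillas ψ (Function.update z k u)

lemma act_inr_withAncillas (k : Fin a) (U : Matrix (Fin 2) (Fin 2) ℂ) (ψ : Vec (Fin n))
    (z : Bits (Fin a)) : act (Sum.inr k) U (withAncillas ψ z) = rotated k U ψ z := by
  funext x
  have h1 : ∀ u, Function.update x (Sum.inr k) u ∘ (Sum.inr : Fin a → Fin n ⊕ Fin a)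
      = Function.update (x ∘ Sum.inr) k u := by
    intro u; exact Function.update_comp_eq_of_injective _ Sum.inr_injective _ _
  have h2 : ∀ u, Function.update x (Sum.inr k) u ∘ (Sum.inl : Fin n → Fin n ⊕ Fin a)
      = x ∘ Sum.inl := by
    intro u; funext k; simp
  simp only [act, rotated, withAncillas, h1, h2, Finset.sum_apply, Pi.smul_apply,
    smul_eq_mul, mul_ite, mul_zero]
  by_cases hx : ∀ l, l ≠ k → x (Sum.inr l) = z l
  · rw [Finset.sum_eq_single (z k), Finset.sum_eq_single (x (Sum.inr k))]
    · rw [if_pos, if_pos]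
      · funext l
        by_cases hl : l = k
        · subst hl; simp
        · simp [Function.update_of_ne hl, hx l hl]
      · funext l
        by_cases hl : l = k
        · subst hl; simp
        · simp [Function.update_of_ne hl, hx l hl]
    · intro u _ hu
      rw [if_neg]
      intro h
      apply hu
      have := congrFun h k
      simpa using this.symm
    · simp
    · intro u _ hu
      rw [if_neg]
      intro h
      apply hu
      have := congrFun h k
      simpa using this
    · simp
  · rw [Finset.sum_eq_zero, Finset.sum_eq_zero]
    · intro u _
      rw [if_neg]
      intro h
      apply hx
      intro l hl
      have := congrFun h l
      simpa [Function.update_of_ne hl] using this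
    · intro u _
      rw [if_neg]
      intro h
      apply hx
      intro l hl
      have := congrFun h l
      simpa [Function.update_of_ne hl] using this

lemma act_add {ι : Type} [DecidableEq ι] (i : ι) (U : Matrix (Fin 2) (Fin 2) ℂ) (Ψ Φ : Vec ι) :
    act i U (Ψ + Φ) = act i U Ψ + act i U Φ := by
  funext x; simp [act, mul_add, Finset.sum_add_distrib]

lemma act_smul {ι : Type} [DecidableEq ι] (i : ι) (U : Matrix (Fin 2) (Fin 2) ℂ) (c : ℂ)
    (Ψ : Vec ι) : act i U (c • Ψ) = c • act i U Ψ := by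
  funext x
  simp only [act, Pi.smul_apply, smul_eq_mul, Finset.mul_sum]
  exact Finset.sum_congr rfl fun u _ => by ring

lemma act_rotated (k : Fin a) (U W : Matrix (Fin 2) (Fin 2) ℂ) (ψ : Vec (Fin n))
    (z : Bits (Fin a)) :
    act (Sum.inr k) W (rotated k U ψ z) = rotated k (W * U) ψ z := by
  have h : ∀ u : Fin 2, rotated k W ψ (Function.update z k u) =
      ∑ v : Fin 2, W v u • withAncillas ψ (Function.update z k v) := fun u => by
    simp [rotated]
  simp only [rotated, Fin.sum_univ_two, act_add, act_smul, act_inr_withAncillas] at h ⊢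
  rw [h, h]
  simp only [Matrix.mul_apply, Fin.sum_univ_two]
  module

lemma rotated_one (k : Fin a) (ψ : Vec (Fin n)) (z : Bits (Fin a)) :
    rotated k 1 ψ z = withAncillas ψ z := by
  rw [rotated, Finset.sum_eq_single (z k)]
  · rw [Function.update_eq_self]
    erw [Matrix.one_apply_eq]
    rw [one_smul]
  · intro u _ hu
    rw [Matrix.one_apply_ne hu, zero_smul]
  · simp

/-- On vectors supported where the control has the value `β`, a controlled gate acts according to
whether `β` is the activating value. -/
lemma controlled_mulVec_of_support {ι : Type} [Fintype ι] [DecidableEq ι] (c : ι) (α β : Fin 2)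
    (t : ι) (h : t ≠ c) (W : Matrix.unitaryGroup (Fin 2) ℂ) (Ψ : Vec ι)
    (hΨ : ∀ x, x c ≠ β → Ψ x = 0) :
    (controlled c α t h W).op *ᵥ Ψ = if β = α then act t W.1 Ψ else Ψ := by
  rw [controlled_mulVec]
  funext x
  have h1 : x c ≠ β → act t W.1 Ψ x = 0 := by
    intro hx
    apply Finset.sum_eq_zero
    intro u _
    rw [hΨ, mul_zero]
    rwa [Function.update_of_ne h.symm]
  by_cases hx : x c = β
  · rw [hx]; split_ifs <;> rfl
  · rw [hΨ x hx, h1 hx, ite_self]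
    split_ifs
    · exact (h1 hx).symm
    · exact (hΨ x hx).symm

lemma controlled_withAncillas (c : Fin a) (α : Fin 2) (t : Fin n ⊕ Fin a) (h : t ≠ Sum.inr c)
    (W : Matrix.unitaryGroup (Fin 2) ℂ) (ψ : Vec (Fin n)) (z : Bits (Fin a)) :
    (controlled (Sum.inr c) α t h W).op *ᵥ withAncillas ψ z =
      if z c = α then act t W.1 (withAncillas ψ z) else withAncillas ψ z := by
  apply controlled_mulVec_of_support
  intro x hx
  rw [withAncillas, if_neg]
  intro h
  exact hx (congrFun h c)

lemma controlled_rotated (c : Fin a) (α : Fin 2) (k : Fin a) (t : Fin n ⊕ Fin a)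
    (h : t ≠ Sum.inr c) (hk : k ≠ c) (W : Matrix.unitaryGroup (Fin 2) ℂ)
    (U : Matrix (Fin 2) (Fin 2) ℂ) (ψ : Vec (Fin n)) (z : Bits (Fin a)) :
    (controlled (Sum.inr c) α t h W).op *ᵥ rotated k U ψ z =
      if z c = α then act t W.1 (rotated k U ψ z) else rotated k U ψ z := by
  apply controlled_mulVec_of_support
  intro x hx
  simp only [rotated, Finset.sum_apply, Pi.smul_apply, withAncillas]
  apply Finset.sum_eq_zero
  intro u _
  rw [if_neg, smul_zero]
  intro h
  apply hx
  have := congrFun h c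
  simpa [Function.update_of_ne hk.symm] using this

end Ancillas

section Computation

variable {n a : ℕ}

/-! ### Circuits that compute Boolean functions on the ancillas -/

/-- A bit as a computational basis label. -/
def toBit (x : ZMod 2) : Fin 2 := if x = 0 then 0 else 1

lemma toBit_injective : Function.Injective toBit := by decide

lemma toBit_add_one (x : ZMod 2) : toBit (x + 1) = 1 - toBit x := by
  revert x; decide

/-- The computational basis label with the entries of `z`. -/
def toBits (z : Fin a → ZMod 2) : Bits (Fin a) := fun k => toBit (z k)

lemma toBits_apply (z : Fin a → ZMod 2) (k : Fin a) : toBits z k = toBit (z k) := rfl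

/-- The state `|ψ⟩ ⊗ |z⟩`, with the values of the ancillas in the field with two elements. -/
def joint (ψ : Vec (Fin n)) (z : Fin a → ZMod 2) : Vec (Fin n ⊕ Fin a) :=
  withAncillas ψ (toBits z)

/-- The bit flip. -/
def gateX : Matrix.unitaryGroup (Fin 2) ℂ :=
  ⟨!![0, 1; 1, 0], by
    rw [Matrix.mem_unitaryGroup_iff, Matrix.star_eq_conjTranspose]
    ext i j
    fin_cases i <;> fin_cases j <;> simp [Matrix.mul_apply, Fin.sum_univ_two]⟩

/-- A square root of the bit flip. -/
noncomputable def gateV : Matrix.unitaryGroup (Fin 2) ℂ :=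
  ⟨!![(1 + Complex.I) / 2, (1 - Complex.I) / 2; (1 - Complex.I) / 2, (1 + Complex.I) / 2], by
    rw [Matrix.mem_unitaryGroup_iff, Matrix.star_eq_conjTranspose]
    ext i j
    fin_cases i <;> fin_cases j <;> simp [Matrix.mul_apply, Fin.sum_univ_two] <;>
      ring_nf <;> simp [Complex.conj_ofNat] <;> norm_num⟩

lemma gateV_mul_self : (gateV : Matrix (Fin 2) (Fin 2) ℂ) * gateV = gateX := by
  ext i j
  fin_cases i <;> fin_cases j <;> simp [gateV, gateX, Matrix.mul_apply, Fin.sum_univ_two] <;>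
      ring_nf <;> simp <;> norm_num

lemma update_toBit (z : Fin a → ZMod 2) (k : Fin a) :
    (Function.update (toBits z) k (1 - toBit (z k))) =
      toBits (z + Pi.single k 1) := by
  funext l
  by_cases hl : l = k
  · subst hl; simp [toBits, toBit_add_one]
  · simp [toBits, Function.update_of_ne hl, Pi.single_eq_of_ne hl]

lemma rotated_gateX (k : Fin a) (ψ : Vec (Fin n)) (z : Fin a → ZMod 2) :
    rotated k gateX.1 ψ (toBits z) = joint ψ (z + Pi.single k 1) := by
  rw [joint, ← update_toBit]
  have h : toBit (z k) = 0 ∨ toBit (z k) = 1 := by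
    generalize z k = x; revert x; decide
  rcases h with h | h <;> simp [rotated, gateX, Fin.sum_univ_two, toBits_apply, h]

lemma act_gateX_rotated (b t : Fin a) (h : b ≠ t) (U : Matrix (Fin 2) (Fin 2) ℂ)
    (ψ : Vec (Fin n)) (z : Fin a → ZMod 2) :
    act (Sum.inr b) gateX.1 (rotated t U ψ (toBits z)) =
      rotated t U ψ (toBits (z + Pi.single b 1)) := by
  have key : ∀ u : Fin 2,
      act (Sum.inr b) gateX.1 (withAncillas ψ (Function.update (toBits z) t u)) =
        withAncillas ψ (Function.update (toBits (z + Pi.single b 1)) t u) := by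
    intro u
    rw [act_inr_withAncillas, ← update_toBit]
    have hb : toBit (z b) = 0 ∨ toBit (z b) = 1 := by
      generalize z b = x; revert x; decide
    rw [Function.update_comm h]
    rcases hb with hb | hb <;>
      simp [rotated, gateX, Fin.sum_univ_two, toBits_apply, hb, Function.update_of_ne h]
  simp only [rotated, Fin.sum_univ_two, act_add, act_smul, key]
  simp [toBits_apply, Pi.single_eq_of_ne h.symm]

/-- The negation of an ancilla `t`, controlled by the condition that the ancilla `c` has the
value `α`. -/
def cnot (c : Fin a) (α : ZMod 2) (t : Fin a) (h : t ≠ c) : Gate (Fin n ⊕ Fin a) :=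
  controlled (Sum.inr c) (toBit α) (Sum.inr t) (by simpa using h) gateX

lemma cnot_joint (c : Fin a) (α : ZMod 2) (t : Fin a) (h : t ≠ c) (ψ : Vec (Fin n))
    (z : Fin a → ZMod 2) :
    (cnot c α t h).op *ᵥ joint ψ z = joint ψ (z + Pi.single t (z c + α + 1)) := by
  rw [cnot, joint, controlled_withAncillas, act_inr_withAncillas, rotated_gateX]
  by_cases hc : z c = α
  · simp [hc, toBits_apply, CharTwo.add_self_eq_zero]
  · have : z c + α + 1 = 0 := by
      generalize z c = x at hc
      revert x α; decide
    simp [this, toBits_apply, toBit_injective.eq_iff, hc, joint]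

lemma cnot_rotated (c : Fin a) (α : ZMod 2) (b t : Fin a) (h : b ≠ c) (hb : b ≠ t) (ht : t ≠ c)
    (U : Matrix (Fin 2) (Fin 2) ℂ) (ψ : Vec (Fin n)) (z : Fin a → ZMod 2) :
    (cnot c α b h).op *ᵥ (rotated t U ψ (toBits z)) =
      rotated t U ψ (toBits (z + Pi.single b (z c + α + 1))) := by
  rw [cnot, controlled_rotated _ _ _ _ _ ht, act_gateX_rotated _ _ hb]
  by_cases hc : z c = α
  · simp [hc, toBits_apply, CharTwo.add_self_eq_zero]
  · have : z c + α + 1 = 0 := by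
      generalize z c = x at hc
      revert x α; decide
    simp [this, toBits_apply, toBit_injective.eq_iff, hc]

lemma controlled_self_rotated (c : Fin a) (α : ZMod 2) (t : Fin a) (h : t ≠ c)
    (W : Matrix.unitaryGroup (Fin 2) ℂ)
    (U : Matrix (Fin 2) (Fin 2) ℂ) (ψ : Vec (Fin n)) (z : Fin a → ZMod 2) :
    (controlled (Sum.inr c) (toBit α) (Sum.inr t) (by simpa using h) W).op *ᵥ
        (rotated t U ψ (toBits z)) =
      rotated t (if z c = α then W.1 * U else U) ψ (toBits z) := by
  rw [controlled_rotated _ _ _ _ _ h, act_rotated]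
  simp only [toBits_apply, toBit_injective.eq_iff]
  split_ifs <;> rfl

/-- The negation of an ancilla `t`, controlled by the condition that the ancillas `b` and `c` have
the values `β` and `γ` (a Toffoli gate). -/
noncomputable def toffoli (b : Fin a) (β : ZMod 2) (c : Fin a) (γ : ZMod 2) (t : Fin a)
    (hb : t ≠ b) (hc : t ≠ c) (hbc : c ≠ b) : List (Gate (Fin n ⊕ Fin a)) :=
  [controlled (Sum.inr c) (toBit γ) (Sum.inr t) (by simpa using hc) gateV,
    cnot b β c hbc,
    controlled (Sum.inr c) (toBit γ) (Sum.inr t) (by simpa using hc) gateV⁻¹,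
    cnot b β c hbc,
    controlled (Sum.inr b) (toBit β) (Sum.inr t) (by simpa using hb) gateV]

lemma twoQubitCount_toffoli (b : Fin a) (β : ZMod 2) (c : Fin a) (γ : ZMod 2) (t : Fin a)
    (hb : t ≠ b) (hc : t ≠ c) (hbc : c ≠ b) :
    twoQubitCount (toffoli (n := n) b β c γ t hb hc hbc) = 5 := rfl

/-- The Toffoli gate applies `V` to the target once for each satisfied control and `V⁻¹` if
exactly one control is satisfied; this is `V² = X` if both are, and trivial otherwise. -/
lemma run_toffoli (b : Fin a) (β : ZMod 2) (c : Fin a) (γ : ZMod 2) (t : Fin a)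
    (hb : t ≠ b) (hc : t ≠ c) (hbc : c ≠ b) (ψ : Vec (Fin n)) (z : Fin a → ZMod 2) :
    run (toffoli b β c γ t hb hc hbc) (joint ψ z) =
      joint ψ (z + Pi.single t ((z b + β + 1) * (z c + γ + 1))) := by
  have hV : (gateV⁻¹ : Matrix.unitaryGroup (Fin 2) ℂ).1 * gateV.1 = 1 :=
    congrArg Subtype.val (inv_mul_cancel gateV)
  have hV' : gateV.1 * (gateV⁻¹ : Matrix.unitaryGroup (Fin 2) ℂ).1 = 1 :=
    congrArg Subtype.val (mul_inv_cancel gateV)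
  have h1 : joint ψ z = rotated t 1 ψ (toBits z) := by
    rw [rotated_one]; rfl
  rw [h1, toffoli]
  simp only [run_cons, run_nil, controlled_self_rotated _ _ _ hb, controlled_self_rotated _ _ _ hc,
    cnot_rotated _ _ _ _ hbc hc.symm hb]
  have hz : z + Pi.single c (z b + β + 1) +
      Pi.single c ((z + Pi.single c (z b + β + 1) : Fin a → ZMod 2) b + β + 1) = z := by
    rw [Pi.add_apply, Pi.single_eq_of_ne hbc.symm, add_zero, add_assoc, ← Pi.single_add,
      CharTwo.add_self_eq_zero, Pi.single_zero, add_zero]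
  rw [hz]
  simp only [Pi.add_apply, Pi.single_eq_same]
  have hcases : (z b = β ∨ z b = β + 1) ∧ (z c = γ ∨ z c = γ + 1) := by
    have h : ∀ x y : ZMod 2, x = y ∨ x = y + 1 := by decide
    exact ⟨h _ _, h _ _⟩
  have hne : ∀ x : ZMod 2, x + 1 ≠ x := by decide
  have h0 : ∀ x y : ZMod 2, x + 1 + x + y = y + 1 := by decide
  have h2 : ∀ x : ZMod 2, x + x + 1 = 1 := by decide
  have h3 : ∀ x : ZMod 2, x + 1 + x + 1 = 0 := by decide
  have h4 : ∀ x : ZMod 2, x + 1 + 1 = x := by decide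
  rcases hcases with ⟨hb' | hb', hc' | hc'⟩
  · rw [hb', hc', h2, h2]
    simp only [hne, if_true, if_false, mul_one]
    rw [gateV_mul_self, rotated_gateX]
  · rw [hb', hc', h2, h3, h4]
    simp only [hne, if_true, if_false, mul_zero, mul_one, hV']
    rw [rotated_one]; simp [joint]
  · rw [hb', hc', h2, h3]
    simp only [hne, if_true, if_false, mul_one, add_zero, hV]
    rw [rotated_one]; simp [joint]
  · rw [hb', hc', h3, h3]
    simp only [hne, if_false, mul_zero, mul_one, add_zero]
    rw [rotated_one]; simp [joint]

end Computation

section Extraction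

variable {n a : ℕ}

/-- An AND of the conditions that the ancillas `b`, `y i`, `c` have the values `β`, `η i`, `γ` is
added to the ancilla `t`, using clean work ancillas `w i` that are restored. In the recursion, `w 0`
takes the conjunction of the first two conditions. -/
lemma exists_and_circuit (c : Fin a) (γ : ZMod 2) (t : Fin a) (htc : t ≠ c) (m : ℕ) :
    ∀ (b : Fin a) (β : ZMod 2) (y w : Fin m → Fin a) (η : Fin m → ZMod 2),
      t ≠ b → c ≠ b → (∀ i, y i ≠ b) → (∀ i, y i ≠ t) → (∀ i, w i ≠ b) → (∀ i, w i ≠ t) →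
      (∀ i, w i ≠ c) → (∀ i j, w i ≠ y j) → Function.Injective w →
      ∃ l : List (Gate (Fin n ⊕ Fin a)), twoQubitCount l = 10 * m + 5 ∧
        ∀ (ψ : Vec (Fin n)) (z : Fin a → ZMod 2), (∀ i, z (w i) = 0) →
          run l (joint ψ z) = joint ψ (z + Pi.single t
            ((z b + β + 1) * (∏ i, (z (y i) + η i + 1)) * (z c + γ + 1))) := by
  induction m with
  | zero =>
    intro b β y w η htb hcb _ _ _ _ _ _ _
    refine ⟨toffoli b β c γ t htb htc hcb, twoQubitCount_toffoli .., fun ψ z _ => ?_⟩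
    rw [run_toffoli]
    simp
  | succ m ih =>
    intro b β y w η htb hcb hyb hyt hwb hwt hwc hwy hw
    obtain ⟨l, hl, hrun⟩ := ih (w 0) 1 (fun i => y i.succ) (fun i => w i.succ)
      (fun i => η i.succ) (hwt 0).symm (hwc 0).symm (fun i => (hwy 0 i.succ).symm)
      (fun i => hyt i.succ) (fun i h => Fin.succ_ne_zero i (hw h)) (fun i => hwt i.succ)
      (fun i => hwc i.succ) (fun i j => hwy i.succ j.succ) (hw.comp (Fin.succ_injective m))
    refine ⟨toffoli b β (y 0) (η 0) (w 0) (hwb 0) (hwy 0 0) (hyb 0) ++ (l ++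
      toffoli b β (y 0) (η 0) (w 0) (hwb 0) (hwy 0 0) (hyb 0)), ?_, fun ψ z hz => ?_⟩
    · rw [twoQubitCount_append, twoQubitCount_append, twoQubitCount_toffoli, hl]
      ring
    · rw [run_append, run_append, run_toffoli, hrun, run_toffoli]
      · congr 1
        have e1 : ∀ (x : ZMod 2) (k : Fin a), k ≠ w 0 →
            (z + Pi.single (w 0) x : Fin a → ZMod 2) k = z k := fun x k hk => by
          rw [Pi.add_apply, Pi.single_eq_of_ne hk, add_zero]
        have e2 : ∀ (x x' : ZMod 2) (k : Fin a), k ≠ w 0 → k ≠ t →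
            (z + Pi.single (w 0) x + Pi.single t x' : Fin a → ZMod 2) k = z k :=
          fun x x' k hk hk' => by
            rw [Pi.add_apply, Pi.single_eq_of_ne hk', add_zero, e1 x k hk]
        rw [e2 _ _ b (hwb 0).symm htb.symm, e2 _ _ (y 0) (hwy 0 0).symm (hyt 0),
          e1 _ c (hwc 0).symm]
        simp only [e1 _ _ (hwy 0 _).symm]
        rw [Pi.add_apply, hz 0, Pi.single_eq_same, add_right_comm, add_assoc z, ← Pi.single_add,
          CharTwo.add_self_eq_zero, Pi.single_zero, add_zero, Fin.prod_univ_succ]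
        congr 2
        have h2 : (1 : ZMod 2) + 1 = 0 := by decide
        linear_combination ((∏ i : Fin m, (z (y i.succ) + η i.succ + 1)) * (z c + γ + 1)) * h2
      · intro i
        rw [Pi.add_apply, hz, Pi.single_eq_of_ne, add_zero]
        exact fun h => Fin.succ_ne_zero i (hw h)

/-- The number of two-qubit gates used for an AND of `r` conditions, `r ≥ 1`. -/
def andCost (r : ℕ) : ℕ := if r = 1 then 1 else 10 * (r - 2) + 5

/-- An AND of `r` conditions on distinct ancillas `y i`. -/
lemma exists_and_circuit' (r : ℕ) (hr : r ≠ 0) (t : Fin a) (y w : Fin r → Fin a)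
    (η : Fin r → ZMod 2) (hy : Function.Injective y) (hw : Function.Injective w)
    (hyt : ∀ i, y i ≠ t) (hwt : ∀ i, w i ≠ t) (hwy : ∀ i j, w i ≠ y j) :
    ∃ l : List (Gate (Fin n ⊕ Fin a)), twoQubitCount l = andCost r ∧
      ∀ (ψ : Vec (Fin n)) (z : Fin a → ZMod 2), (∀ i, z (w i) = 0) →
        run l (joint ψ z) = joint ψ (z + Pi.single t (∏ i, (z (y i) + η i + 1))) := by
  match r, hr with
  | 1, _ =>
    refine ⟨[cnot (y 0) (η 0) t (hyt 0).symm], rfl, fun ψ z _ => ?_⟩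
    rw [run_cons, run_nil, cnot_joint]
    simp
  | m + 2, _ =>
    obtain ⟨l, hl, hrun⟩ := exists_and_circuit (n := n) (y (Fin.last (m + 1)))
      (η (Fin.last (m + 1))) t (hyt _).symm m (y 0) (η 0)
      (fun i => y i.castSucc.succ) (fun i => w i.castSucc.succ)
      (fun i => η i.castSucc.succ) (hyt _).symm (fun h => by simpa using hy h)
      (fun i h => Fin.succ_ne_zero _ (hy h)) (fun i => hyt _) (fun i => hwy _ _) (fun i => hwt _)
      (fun i => hwy _ _) (fun i j => hwy _ _)
      (hw.comp ((Fin.succ_injective _).comp (Fin.castSucc_injective _)))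
    refine ⟨l, by simp [hl, andCost], fun ψ z hz => ?_⟩
    rw [hrun ψ z fun i => hz _]
    congr 3
    rw [Fin.prod_univ_succ, Fin.prod_univ_castSucc, mul_assoc]
    rfl

/-! ### Extraction of the eigenvalue of a Pauli operator -/

/-- The Hadamard gate. -/
noncomputable def gateH : Matrix.unitaryGroup (Fin 2) ℂ :=
  ⟨((Real.sqrt 2 : ℂ))⁻¹ • !![1, 1; 1, -1], by
    have h : ((Real.sqrt 2 : ℂ))⁻¹ * ((Real.sqrt 2 : ℂ))⁻¹ = 1 / 2 := by
      rw [← mul_inv, ← Complex.ofReal_mul, Real.mul_self_sqrt (by norm_num)]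
      norm_num
    rw [Matrix.mem_unitaryGroup_iff, Matrix.star_eq_conjTranspose, Matrix.conjTranspose_smul,
      Matrix.smul_mul, Matrix.mul_smul, smul_smul]
    have h' : star ((Real.sqrt 2 : ℂ))⁻¹ = ((Real.sqrt 2 : ℂ))⁻¹ := by
      simp [Complex.conj_ofReal]
    rw [h', h]
    ext i j
    fin_cases i <;> fin_cases j <;>
      simp [Matrix.mul_apply, Fin.sum_univ_two, Matrix.smul_apply, -Matrix.cons_mul] <;> norm_num⟩

lemma gateH_mul_self : (gateH : Matrix (Fin 2) (Fin 2) ℂ) * gateH = 1 := by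
  have h := Matrix.mem_unitaryGroup_iff.1 gateH.2
  have h' : star (gateH : Matrix (Fin 2) (Fin 2) ℂ) = gateH := by
    rw [Matrix.star_eq_conjTranspose]
    ext i j
    fin_cases i <;> fin_cases j <;>
      simp [gateH, Matrix.conjTranspose_apply, Complex.conj_ofReal]
  rwa [h'] at h

/-- The gate that multiplies `|1⟩` by the phase `ε`. -/
def gatePhase (ε : ℂ) (hε : ε * star ε = 1) : Matrix.unitaryGroup (Fin 2) ℂ :=
  ⟨!![1, 0; 0, ε], by
    rw [Matrix.mem_unitaryGroup_iff, Matrix.star_eq_conjTranspose]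
    ext i j
    fin_cases i <;> fin_cases j <;> simp [Matrix.mul_apply, Fin.sum_univ_two]
    simpa using hε⟩

/-- A Pauli matrix as a gate. -/
def Pauli.gate (p : Pauli) : Matrix.unitaryGroup (Fin 2) ℂ :=
  ⟨p.mat, by
    rw [Matrix.mem_unitaryGroup_iff, Matrix.star_eq_conjTranspose, Pauli.mat_conjTranspose,
      Pauli.mat_mul_self]⟩

lemma act_eq_tensor_mulVec (q : Fin n) (U : Matrix.unitaryGroup (Fin 2) ℂ) (ψ : Vec (Fin n)) :
    act q U.1 ψ = tensor (Pi.mulSingle q U.1) *ᵥ ψ := by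
  rw [← one_mulVec]
  congr 1
  ext x y
  rw [tensor, Matrix.of_apply, ← Finset.mul_prod_erase _ _ (Finset.mem_univ q),
    Pi.mulSingle_eq_same]
  simp only [Gate.op, Matrix.of_apply]
  split_ifs with h
  · rw [Finset.prod_eq_one, mul_one]
    intro l hl
    rw [Pi.mulSingle_eq_of_ne (Finset.ne_of_mem_erase hl), h l (Finset.ne_of_mem_erase hl),
      Matrix.one_apply_eq]
  · push Not at h
    obtain ⟨l, hl, hne⟩ := h
    rw [Finset.prod_eq_zero (Finset.mem_erase.2 ⟨hl, Finset.mem_univ l⟩), mul_zero]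
    rw [Pi.mulSingle_eq_of_ne hl, Matrix.one_apply_ne hne]

/-- Controlled Pauli gates on the qubits in `l`. -/
def controlledPaulis (k : Fin a) (p : Fin n → Pauli) (l : List (Fin n)) :
    List (Gate (Fin n ⊕ Fin a)) :=
  l.map fun q => controlled (Sum.inr k) 1 (Sum.inl q) (by simp) (p q).gate

lemma run_controlledPaulis (k : Fin a) (p : Fin n → Pauli) (l : List (Fin n)) (hl : l.Nodup)
    (ψ : Vec (Fin n)) (z : Bits (Fin a)) :
    run (controlledPaulis k p l) (withAncillas ψ z) =
      withAncillas (if z k = 1 then tensor (fun q => if q ∈ l then (p q).mat else 1) *ᵥ ψ else ψ)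
        z := by
  induction l generalizing ψ with
  | nil =>
    have : (fun q : Fin n => if q ∈ ([] : List (Fin n)) then (p q).mat else 1) = 1 := by
      funext q; simp
    rw [this, tensor_one, Matrix.one_mulVec, ite_self]
    exact run_nil _
  | cons q l ih =>
    rw [controlledPaulis, List.map_cons, run_cons, controlled_withAncillas, act_inl_withAncillas,
      act_eq_tensor_mulVec]
    rw [controlledPaulis] at ih
    rw [List.nodup_cons] at hl
    split_ifs with h
    · rw [ih hl.2, if_pos h, Matrix.mulVec_mulVec, tensor_mul]
      congr 3
      funext q'
      by_cases hq : q' = q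
      · subst hq; simp [hl.1, Pauli.gate]
      · simp [hq, Pi.mulSingle_eq_of_ne]
    · rw [ih hl.2, if_neg h]

lemma one_inr_withAncillas (k : Fin a) (V : Matrix.unitaryGroup (Fin 2) ℂ) (ψ : Vec (Fin n))
    (z : Bits (Fin a)) :
    (Gate.one (Sum.inr k) V).op *ᵥ withAncillas ψ z = rotated k V.1 ψ z := by
  rw [one_mulVec, act_inr_withAncillas]

/-- Phase estimation of a Pauli operator with `n` two-qubit gates: on an eigenvector, the eigenvalue
`(-1)^s` is added as the bit `s` to the ancilla `k`. -/
lemma exists_extract_circuit (k : Fin a) (p : Fin n → Pauli) (ε : ℂ) (hε : ε * star ε = 1) :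
    ∃ l : List (Gate (Fin n ⊕ Fin a)), twoQubitCount l = n ∧
      ∀ (ψ : Vec (Fin n)) (s : ZMod 2), (ε • pauliOp p) *ᵥ ψ = sgn s • ψ →
        ∀ z : Fin a → ZMod 2, run l (joint ψ z) = joint ψ (z + Pi.single k s) := by
  refine ⟨[.one (.inr k) gateH] ++ (controlledPaulis k p (List.finRange n) ++
    [.one (.inr k) (gatePhase ε hε), .one (.inr k) gateH]), ?_, fun ψ s hs z => ?_⟩
  · have h : ∀ l, twoQubitCount (controlledPaulis k p l) = l.length := by
      intro l
      induction l with
      | nil => rfl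
      | cons q l ih =>
        change 1 + twoQubitCount (controlledPaulis k p l) = _
        rw [ih, List.length_cons, add_comm]
    rw [twoQubitCount_append, twoQubitCount_append, h, List.length_finRange]
    simp [twoQubitCount, Gate.cost]
  · -- Between the Hadamard gates, `|1⟩` on the ancilla acquires the eigenvalue as a phase.
    have hp : tensor (fun q => if q ∈ List.finRange n then (p q).mat else 1) = pauliOp p := by
      simp [List.mem_finRange, pauliOp_eq_tensor]
    have hphase : ∀ (φ : Vec (Fin n)) (z : Bits (Fin a)), (Gate.one (Sum.inr k)
        (gatePhase ε hε)).op *ᵥ withAncillas φ z =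
          (if z k = 1 then ε else 1) • withAncillas φ z := by
      intro φ z
      rw [one_inr_withAncillas]
      rcases (by omega : z k = 0 ∨ z k = 1) with h | h
      · have : Function.update z k 0 = z := by rw [← h, Function.update_eq_self]
        simp [rotated, gatePhase, h, this]
      · have : Function.update z k 1 = z := by rw [← h, Function.update_eq_self]
        simp [rotated, gatePhase, h, this]
    have hmid : ∀ z : Bits (Fin a), run (controlledPaulis k p (List.finRange n) ++
        [.one (.inr k) (gatePhase ε hε)]) (withAncillas ψ z) =
          (if z k = 1 then sgn s else 1) • withAncillas ψ z := by
      intro z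
      rw [run_append, run_controlledPaulis _ _ _ (List.nodup_finRange n), run_cons, run_nil, hphase,
        hp]
      split_ifs with h
      · rw [← withAncillas_smul, ← Matrix.smul_mulVec, hs, withAncillas_smul]
      · rfl
    have hsplit : [.one (.inr k) gateH] ++ (controlledPaulis k p (List.finRange n) ++
        [.one (.inr k) (gatePhase ε hε), .one (.inr k) gateH]) =
        [.one (.inr k) gateH] ++ ((controlledPaulis k p (List.finRange n) ++
        [.one (.inr k) (gatePhase ε hε)]) ++ [.one (.inr k) gateH]) := by simp
    have hH : run (controlledPaulis k p (List.finRange n) ++ [.one (.inr k) (gatePhase ε hε)])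
        (rotated k gateH.1 ψ (toBits z)) = rotated k gateH.1 ψ (toBits (z + Pi.single k s)) := by
      have hu : ∀ u, Function.update (toBits (z + Pi.single k s)) k u =
          Function.update (toBits z) k u := by
        intro u
        funext l
        by_cases hl : l = k
        · subst hl; simp
        · simp [hl, toBits]
      simp only [rotated, Fin.sum_univ_two, run_add, run_smul, hmid, hu]
      rw [toBits_apply, toBits_apply, Pi.add_apply, Pi.single_eq_same]
      rcases zmod_two_cases (z k) with h | h <;> rcases zmod_two_cases s with h' | h' <;>
        simp [h, h', toBit, gateH, sgn, CharTwo.add_self_eq_zero]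
    rw [hsplit, run_append, run_append, run_cons (Gate.one (Sum.inr k) gateH) [] (joint ψ z),
      run_nil, joint, one_inr_withAncillas, hH, run_cons, run_nil, one_mulVec, act_rotated,
      gateH_mul_self, rotated_one, joint]

end Extraction

/-! ### Syndromes and observables that are functions of the syndrome -/

section Stabilizer

variable {n r : ℕ} {G : Fin r → Op (Fin n)}

/-- The homomorphism from the group with two elements given by an involution. -/
def involutionHom (A : Op (Fin n)) (h : A * A = 1) : Multiplicative (ZMod 2) →* Op (Fin n) where
  toFun x := if x.toAdd = 0 then 1 else A
  map_one' := by simp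
  map_mul' x y := by
    rw [toAdd_mul]
    rcases zmod_two_cases x.toAdd with hx | hx <;> rcases zmod_two_cases y.toAdd with hy | hy <;>
      simp [hx, hy, h, CharTwo.add_self_eq_zero]

lemma IsStabilizerGenerators.mul_self (hG : IsStabilizerGenerators G) (i : Fin r) :
    G i * G i = 1 := by
  have h := (hG.pauli i).conjTranspose_mul_self
  rwa [(hG.hermitian i).eq] at h

/-- The element `∏ i, G i ^ v i` of the stabilizer group. -/
noncomputable def stabOp (hG : IsStabilizerGenerators G) (v : Fin r → ZMod 2) : Op (Fin n) :=
  MonoidHom.noncommPiCoprod (fun i => involutionHom (G i) (hG.mul_self i)) (by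
      intro i j _ x y
      simp only [involutionHom, MonoidHom.coe_mk, OneHom.coe_mk]
      split_ifs
      · exact Commute.one_left _
      · exact Commute.one_left _
      · exact Commute.one_right _
      · exact hG.commute i j)
    (fun i => Multiplicative.ofAdd (v i))

variable (hG : IsStabilizerGenerators G)

lemma stabOp_zero : stabOp hG 0 = 1 := map_one _

lemma stabOp_add (v w : Fin r → ZMod 2) : stabOp hG (v + w) = stabOp hG v * stabOp hG w :=
  map_mul _ _ _

lemma stabOp_single_one (i : Fin r) : stabOp hG (Pi.single i 1) = G i := by
  have h : (fun j => Multiplicative.ofAdd ((Pi.single i 1 : Fin r → ZMod 2) j)) =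
      Pi.mulSingle i (Multiplicative.ofAdd (1 : ZMod 2)) := by
    funext j
    by_cases hj : j = i
    · subst hj; simp
    · simp [hj, Pi.mulSingle_eq_of_ne]
  rw [stabOp, h]
  refine (MonoidHom.noncommPiCoprod_mulSingle _ _ _).trans ?_
  simp [involutionHom]

/-- The vectors `v` form a group generated by the unit vectors. -/
lemma bits_induction {p : (Fin r → ZMod 2) → Prop} (zero : p 0)
    (add : ∀ v w, p v → p w → p (v + w)) (single : ∀ i, p (Pi.single i 1)) (v : Fin r → ZMod 2) :
    p v := by
  refine Pi.single_induction p v zero add fun i x => ?_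
  rcases zmod_two_cases x with rfl | rfl
  · rwa [Pi.single_zero]
  · exact single i

lemma stabOp_commute (v w : Fin r → ZMod 2) : stabOp hG v * stabOp hG w =
    stabOp hG w * stabOp hG v := by
  rw [← stabOp_add, ← stabOp_add, add_comm]

lemma stabOp_isPauli (v : Fin r → ZMod 2) : IsPauli (stabOp hG v) := by
  induction v using bits_induction with
  | zero => rw [stabOp_zero]; exact IsPauli.one
  | add v w hv hw => rw [stabOp_add]; exact hv.mul hw
  | single i => rw [stabOp_single_one]; exact hG.pauli i

lemma stabOp_isHermitian (v : Fin r → ZMod 2) : (stabOp hG v).IsHermitian := by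
  induction v using bits_induction with
  | zero => rw [stabOp_zero]; exact Matrix.isHermitian_one
  | add v w hv hw =>
    rw [Matrix.IsHermitian, stabOp_add, Matrix.conjTranspose_mul, hv.eq, hw.eq, stabOp_commute]
  | single i => rw [stabOp_single_one]; exact hG.hermitian i

variable (G) in
/-- The joint eigenspace of the stabilizer generators with syndrome `s`. -/
def syndromeSpace (s : Fin r → ZMod 2) : Submodule ℂ (Vec (Fin n)) where
  carrier := {ψ | ∀ i, G i *ᵥ ψ = sgn (s i) • ψ}
  add_mem' := by
    intro a b ha hb i
    rw [Matrix.mulVec_add, ha i, hb i, smul_add]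
  zero_mem' := by
    intro i
    rw [Matrix.mulVec_zero, smul_zero]
  smul_mem' := by
    intro c a ha i
    rw [Matrix.mulVec_smul, ha i, smul_comm]

lemma stabOp_mulVec {s : Fin r → ZMod 2} {ψ : Vec (Fin n)} (hψ : ψ ∈ syndromeSpace G s)
    (v : Fin r → ZMod 2) : stabOp hG v *ᵥ ψ = sgn (v ⬝ᵥ s) • ψ := by
  induction v using bits_induction with
  | zero => rw [stabOp_zero, Matrix.one_mulVec, zero_dotProduct, sgn_zero, one_smul]
  | add v w hv hw =>
    rw [stabOp_add, ← Matrix.mulVec_mulVec, hw, Matrix.mulVec_smul, hv, smul_smul, add_dotProduct,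
      sgn_add, mul_comm]
  | single i => rw [stabOp_single_one, hψ i, single_one_dotProduct]

/-- Orthogonality of the characters of the group of syndromes. -/
lemma sum_sgn_dotProduct (v : Fin r → ZMod 2) :
    ∑ s : Fin r → ZMod 2, sgn (v ⬝ᵥ s) = if v = 0 then 2 ^ r else 0 := by
  split_ifs with hv
  · subst hv
    simp [sgn_zero, ZMod.card]
  · obtain ⟨i, hi⟩ := Function.ne_iff.1 hv
    have hi1 : v i = 1 := (zmod_two_cases (v i)).resolve_left hi
    have h : ∑ s : Fin r → ZMod 2, sgn (v ⬝ᵥ (s + Pi.single i 1)) =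
        ∑ s : Fin r → ZMod 2, sgn (v ⬝ᵥ s) :=
      Fintype.sum_equiv (Equiv.addRight (Pi.single i 1)) _ _ fun _ => rfl
    simp only [dotProduct_add, dotProduct_single_one, hi1, sgn_add, sgn_one, mul_neg, mul_one,
      Finset.sum_neg_distrib] at h
    linear_combination -(1 / 2) * h

/-- The orthogonal projection onto the joint eigenspace with syndrome `s`. -/
noncomputable def syndromeProj (s : Fin r → ZMod 2) : Op (Fin n) :=
  ((2 : ℂ) ^ r)⁻¹ • ∑ v, sgn (v ⬝ᵥ s) • stabOp hG v

lemma syndromeProj_mulVec_mem (s : Fin r → ZMod 2) (ψ : Vec (Fin n)) :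
    syndromeProj hG s *ᵥ ψ ∈ syndromeSpace G s := by
  intro i
  rw [Matrix.mulVec_mulVec, ← Matrix.smul_mulVec]
  congr 1
  have h : G i * ∑ v, sgn (v ⬝ᵥ s) • stabOp hG v =
      sgn (s i) • ∑ v, sgn (v ⬝ᵥ s) • stabOp hG v := ?_
  · rw [syndromeProj, Matrix.mul_smul, smul_comm (sgn (s i)), h]
  rw [Finset.mul_sum, Finset.smul_sum]
  let e : Fin r → ZMod 2 := Pi.single i 1
  refine Fintype.sum_equiv (Equiv.addLeft e) _ _ fun v => ?_
  rw [Equiv.coe_addLeft, stabOp_add, stabOp_single_one, add_dotProduct, single_one_dotProduct,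
    sgn_add, smul_smul, ← mul_assoc, sgn_mul_self, one_mul, Matrix.mul_smul]

lemma sum_syndromeProj : ∑ s, syndromeProj hG s = 1 := by
  simp only [syndromeProj]
  rw [← Finset.smul_sum, Finset.sum_comm]
  simp only [← Finset.sum_smul, sum_sgn_dotProduct, ite_smul, zero_smul]
  rw [Finset.sum_ite_eq' Finset.univ, if_pos (Finset.mem_univ _), stabOp_zero, smul_smul,
    inv_mul_cancel₀ (pow_ne_zero _ two_ne_zero), one_smul]

lemma syndromeProj_mulVec {s s' : Fin r → ZMod 2} {ψ : Vec (Fin n)}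
    (hψ : ψ ∈ syndromeSpace G s) :
    syndromeProj hG s' *ᵥ ψ = if s' = s then ψ else 0 := by
  rw [syndromeProj, Matrix.smul_mulVec, Matrix.sum_mulVec]
  simp only [Matrix.smul_mulVec, stabOp_mulVec hG hψ, smul_smul, ← sgn_add, ← dotProduct_add]
  rw [← Finset.sum_smul]
  have h := sum_sgn_dotProduct (s' + s)
  simp only [dotProduct_comm (s' + s)] at h
  rw [h, smul_smul]
  have h' : s' + s = 0 ↔ s' = s := by
    constructor
    · intro h
      funext i
      have := congrFun h i
      rw [Pi.add_apply, Pi.zero_apply] at this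
      exact CharTwo.add_eq_zero.1 this
    · rintro rfl
      funext i
      exact CharTwo.add_self_eq_zero _
  simp only [h']
  split_ifs
  · rw [inv_mul_cancel₀ (pow_ne_zero _ two_ne_zero), one_smul]
  · rw [mul_zero, zero_smul]

lemma syndromeProj_isHermitian (s : Fin r → ZMod 2) : (syndromeProj hG s).IsHermitian := by
  rw [Matrix.IsHermitian, syndromeProj, Matrix.conjTranspose_smul, Matrix.conjTranspose_sum]
  congr 1
  · simp
  · refine Finset.sum_congr rfl fun v _ => ?_
    rw [Matrix.conjTranspose_smul, star_sgn, (stabOp_isHermitian hG v).eq]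

include hG in
/-- The joint eigenspaces span the whole space. -/
lemma syndrome_induction {p : Vec (Fin n) → Prop} (add : ∀ ψ φ, p ψ → p φ → p (ψ + φ))
    (mem : ∀ s, ∀ ψ ∈ syndromeSpace G s, p ψ) (ψ : Vec (Fin n)) : p ψ := by
  have h : ψ = ∑ s, syndromeProj hG s *ᵥ ψ := by
    rw [← Matrix.sum_mulVec, sum_syndromeProj, Matrix.one_mulVec]
  rw [h]
  exact Finset.sum_induction _ p add (mem 0 0 (Submodule.zero_mem _))
    fun s _ => mem s _ (syndromeProj_mulVec_mem hG s ψ)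

/-- The observable with the value `(-1) ^ f s` on the states of syndrome `s`. -/
noncomputable def syndromeObservable (f : (Fin r → ZMod 2) → ZMod 2) : Op (Fin n) :=
  ∑ s, sgn (f s) • syndromeProj hG s

lemma syndromeObservable_mulVec (f : (Fin r → ZMod 2) → ZMod 2) {s : Fin r → ZMod 2}
    {ψ : Vec (Fin n)} (hψ : ψ ∈ syndromeSpace G s) :
    syndromeObservable hG f *ᵥ ψ = sgn (f s) • ψ := by
  rw [syndromeObservable, Matrix.sum_mulVec]
  simp only [Matrix.smul_mulVec, syndromeProj_mulVec hG hψ, smul_ite, smul_zero]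
  rw [Finset.sum_ite_eq' Finset.univ, if_pos (Finset.mem_univ _)]

lemma syndromeObservable_isHermitian (f : (Fin r → ZMod 2) → ZMod 2) :
    (syndromeObservable hG f).IsHermitian := by
  rw [Matrix.IsHermitian, syndromeObservable, Matrix.conjTranspose_sum]
  refine Finset.sum_congr rfl fun v _ => ?_
  rw [Matrix.conjTranspose_smul, star_sgn, (syndromeProj_isHermitian hG v).eq]

lemma syndromeObservable_mul_self (f : (Fin r → ZMod 2) → ZMod 2) :
    syndromeObservable hG f * syndromeObservable hG f = 1 := by
  apply Matrix.ext_of_mulVec_single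
  intro x
  induction (Pi.single x 1 : Vec (Fin n)) using syndrome_induction hG with
  | add ψ φ hψ hφ => rw [Matrix.mulVec_add, Matrix.mulVec_add, hψ, hφ]
  | mem s ψ hψ =>
    rw [← Matrix.mulVec_mulVec, syndromeObservable_mulVec hG f hψ, Matrix.mulVec_smul,
      syndromeObservable_mulVec hG f hψ, smul_smul, sgn_mul_self, one_smul, Matrix.one_mulVec]

lemma toBits_zero {a : ℕ} : toBits (0 : Fin a → ZMod 2) = 0 := rfl

lemma toBits_single_one {a : ℕ} (k : Fin a) : toBits (Pi.single k 1) = Pi.single k 1 := by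
  funext l
  by_cases hl : l = k
  · subst hl; simp [toBits, toBit]
  · simp [toBits, toBit, hl]

/-- A circuit that computes the function `f` of the syndrome in the ancilla `0` realizes the
measurement of the observable belonging to `f`. -/
lemma exists_measurement (f : (Fin r → ZMod 2) → ZMod 2) (a : ℕ)
    (l : List (Gate (Fin n ⊕ Fin (a + 1))))
    (h : ∀ s, ∀ ψ ∈ syndromeSpace G s, run l (joint ψ 0) = joint ψ (Pi.single 0 (f s))) :
    ∃ m : Measurement n, m.M = syndromeObservable hG f ∧
      twoQubitCount m.circuit = twoQubitCount l := by
  refine ⟨⟨syndromeObservable hG f, syndromeObservable_isHermitian hG f,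
    syndromeObservable_mul_self hG f, a, l, fun ψ => ?_⟩, rfl, rfl⟩
  induction ψ using syndrome_induction hG with
  | add ψ φ hψ hφ =>
    simp only [withAncillas_add, Matrix.mulVec_add]
    rw [hψ, hφ]
    abel
  | mem s ψ hψ =>
    have h' := h s ψ hψ
    rw [joint, toBits_zero, run] at h'
    rw [h', Matrix.smul_mulVec, Matrix.smul_mulVec, Matrix.add_mulVec, Matrix.sub_mulVec,
      syndromeObservable_mulVec hG f hψ, Matrix.one_mulVec, joint]
    have h0 : ∀ z : Bits (Fin (a + 1)), withAncillas (0 : Vec (Fin n)) z = 0 := by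
      intro z; funext x; simp [withAncillas]
    have h2 : (1 / 2 : ℂ) • (ψ + ψ) = ψ := by module
    rcases zmod_two_cases (f s) with hf | hf
    · simp only [hf, sgn_zero, one_smul, sub_self, smul_zero, Pi.single_zero, toBits_zero, h0, h2,
        add_zero]
    · simp only [hf, sgn_one, neg_smul, one_smul, add_neg_cancel, smul_zero, h0, zero_add,
        sub_neg_eq_add, toBits_single_one, h2]

end Stabilizer

/-! ### Measurements of Boolean functions of the syndrome -/

section SyndromeMeasurements

variable {n r : ℕ} {G : Fin r → Op (Fin n)} (hG : IsStabilizerGenerators G)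

include hG in
/-- Adding the linear function `v` of the syndrome to the ancilla `k`. -/
lemma exists_linear_circuit {a : ℕ} (k : Fin a) (v : Fin r → ZMod 2) :
    ∃ l : List (Gate (Fin n ⊕ Fin a)), twoQubitCount l = n ∧
      ∀ s, ∀ ψ ∈ syndromeSpace G s, ∀ z : Fin a → ZMod 2,
        run l (joint ψ z) = joint ψ (z + Pi.single k (v ⬝ᵥ s)) := by
  obtain ⟨m, p, h⟩ := isPauli_iff.1 (stabOp_isPauli hG v)
  obtain ⟨l, hl, hrun⟩ := exists_extract_circuit k p (Complex.I ^ m)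
    (by rw [mul_comm, star_I_pow_mul])
  exact ⟨l, hl, fun s ψ hψ z => hrun ψ _ (by rw [← h, stabOp_mulVec hG hψ]) z⟩

include hG in
lemma exists_linear_circuits {a ρ : ℕ} (y : Fin ρ → Fin a) (b : Fin ρ → Fin r → ZMod 2)
    (I : List (Fin ρ)) :
    ∃ l : List (Gate (Fin n ⊕ Fin a)), twoQubitCount l = I.length * n ∧
      ∀ s, ∀ ψ ∈ syndromeSpace G s, ∀ z : Fin a → ZMod 2,
        run l (joint ψ z) =
          joint ψ (z + (I.map fun i => (Pi.single (y i) (b i ⬝ᵥ s) : Fin a → ZMod 2)).sum) := by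
  induction I with
  | nil => exact ⟨[], by simp [twoQubitCount], fun s ψ _ z => by simp [run_nil]⟩
  | cons i I ih =>
    obtain ⟨l, hl, hrun⟩ := ih
    obtain ⟨l', hl', hrun'⟩ := exists_linear_circuit hG (y i) (b i)
    refine ⟨l' ++ l, ?_, fun s ψ hψ z => ?_⟩
    · rw [twoQubitCount_append, hl, hl', List.length_cons]; ring
    · rw [run_append, hrun' s ψ hψ, hrun s ψ hψ, List.map_cons, List.sum_cons, add_assoc]

/-- Adding the number (mod 2) of matching patterns of the list `J` to the ancilla `t`. -/
lemma exists_patterns_circuit {a ρ : ℕ} (hρ : ρ ≠ 0) (t : Fin a) (y w : Fin ρ → Fin a)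
    (hy : Function.Injective y) (hw : Function.Injective w)
    (hyt : ∀ i, y i ≠ t) (hwt : ∀ i, w i ≠ t) (hwy : ∀ i j, w i ≠ y j)
    (J : List (Fin ρ → ZMod 2)) :
    ∃ l : List (Gate (Fin n ⊕ Fin a)), twoQubitCount l = J.length * andCost ρ ∧
      ∀ (ψ : Vec (Fin n)) (z : Fin a → ZMod 2), (∀ i, z (w i) = 0) →
        run l (joint ψ z) = joint ψ
          (z + Pi.single t (J.map fun c => ∏ i, (z (y i) + c i + 1)).sum) := by
  induction J with
  | nil => exact ⟨[], by simp [twoQubitCount], fun ψ z _ => by simp [run_nil]⟩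
  | cons c J ih =>
    obtain ⟨l, hl, hrun⟩ := ih
    obtain ⟨l', hl', hrun'⟩ := exists_and_circuit' (n := n) ρ hρ t y w c hy hw hyt hwt hwy
    refine ⟨l' ++ l, ?_, fun ψ z hz => ?_⟩
    · rw [twoQubitCount_append, hl, hl', List.length_cons]; ring
    · rw [run_append, hrun' ψ z hz, hrun]
      · simp only [Pi.add_apply, Pi.single_eq_of_ne (hyt _), add_zero]
        rw [add_assoc, ← Pi.single_add, List.map_cons, List.sum_cons]
      · intro i
        rw [Pi.add_apply, Pi.single_eq_of_ne (hwt i), add_zero, hz i]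

/-- The measurement of a stabilizer element. -/
lemma exists_linear_measurement (v : Fin r → ZMod 2) :
    ∃ m : Measurement n, m.M = syndromeObservable hG (fun s => v ⬝ᵥ s) ∧
      twoQubitCount m.circuit = n := by
  obtain ⟨l, hl, hrun⟩ := exists_linear_circuit hG (0 : Fin 1) v
  obtain ⟨m, hm, hm'⟩ := exists_measurement hG (fun s => v ⬝ᵥ s) 0 l fun s ψ hψ =>
    (hrun s ψ hψ 0).trans (congrArg _ (zero_add _))
  exact ⟨m, hm, hm'.trans hl⟩

/-- The measurement of a function of the syndrome that is the sum of a linear function and of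
indicator functions of affine subspaces with the common defining forms `b i`. The values of these
forms are computed, used for all subspaces, and uncomputed. -/
lemma exists_pattern_measurement {ρ : ℕ} (hρ : ρ ≠ 0) (v : Fin r → ZMod 2)
    (b : Fin ρ → Fin r → ZMod 2) (J : List (Fin ρ → ZMod 2)) :
    ∃ m : Measurement n, m.M = syndromeObservable hG
        (fun s => v ⬝ᵥ s + (J.map fun c => ∏ i, (b i ⬝ᵥ s + c i + 1)).sum) ∧
      twoQubitCount m.circuit = n + 2 * ρ * n + J.length * andCost ρ := by
  let y : Fin ρ → Fin (ρ + ρ + 1) := fun i => (Fin.castAdd ρ i).succ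
  let w : Fin ρ → Fin (ρ + ρ + 1) := fun i => (Fin.natAdd ρ i).succ
  have hy : Function.Injective y := (Fin.succ_injective _).comp (Fin.castAdd_injective _ _)
  have hw : Function.Injective w := (Fin.succ_injective _).comp (Fin.natAdd_injective _ _)
  have hyt : ∀ i, y i ≠ 0 := fun i => Fin.succ_ne_zero _
  have hwt : ∀ i, w i ≠ 0 := fun i => Fin.succ_ne_zero _
  have hwy : ∀ i j, w i ≠ y j := by
    intro i j h
    have := congrArg Fin.val h
    simp [w, y] at this
    omega
  obtain ⟨l₁, hl₁, hrun₁⟩ := exists_linear_circuits hG y b (List.finRange ρ)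
  obtain ⟨l₂, hl₂, hrun₂⟩ :=
    exists_patterns_circuit (n := n) hρ 0 y w hy hw hyt hwt hwy J
  obtain ⟨l₃, hl₃, hrun₃⟩ := exists_linear_circuit hG (0 : Fin (ρ + ρ + 1)) v
  obtain ⟨m, hm, hm'⟩ := exists_measurement hG
    (fun s => v ⬝ᵥ s + (J.map fun c => ∏ i, (b i ⬝ᵥ s + c i + 1)).sum) (ρ + ρ)
    (l₁ ++ (l₂ ++ (l₁ ++ l₃))) fun s ψ hψ => by
      rw [run_append, run_append, run_append, hrun₁ s ψ hψ, hrun₂, hrun₁ s ψ hψ, hrun₃ s ψ hψ]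
      · rw [← Fin.sum_univ_def]
        congr 1
        have hz : ∀ i, (0 + ∑ j, Pi.single (y j) (b j ⬝ᵥ s) : Fin (ρ + ρ + 1) → ZMod 2) (y i) =
            b i ⬝ᵥ s := by
          intro i
          rw [zero_add, Finset.sum_apply, Finset.sum_eq_single i, Pi.single_eq_same]
          · intro j _ hj
            rw [Pi.single_eq_of_ne fun h => hj (hy h).symm]
          · simp
        simp only [hz]
        rw [zero_add, add_right_comm (∑ j, (Pi.single (y j) (b j ⬝ᵥ s) : Fin _ → ZMod 2)),
          ← Finset.sum_add_distrib]
        simp only [← Pi.single_add, CharTwo.add_self_eq_zero,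
          Finset.sum_const_zero, zero_add]
        exact congrArg _ (add_comm _ _)
      · intro i
        rw [← Fin.sum_univ_def, zero_add, Finset.sum_apply]
        exact Finset.sum_eq_zero fun j _ => Pi.single_eq_of_ne (hwy i j) _
  refine ⟨m, hm, ?_⟩
  rw [hm']
  simp only [twoQubitCount_append, hl₁, hl₂, hl₃, List.length_finRange]
  ring

/-- A linear functional on bit vectors, as a dot product. -/
lemma exists_dotProduct_eq (φ : (Fin r → ZMod 2) →ₗ[ZMod 2] ZMod 2) :
    ∃ v : Fin r → ZMod 2, ∀ s, v ⬝ᵥ s = φ s := by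
  refine ⟨fun i => φ (Pi.single i 1), fun s => ?_⟩
  rw [LinearMap.pi_apply_eq_sum_univ φ s]
  simp only [dotProduct, smul_eq_mul]
  refine Finset.sum_congr rfl fun i _ => ?_
  rw [mul_comm]
  congr 2
  funext j
  simp [Pi.single_apply, eq_comm]

/-- A subspace is cut out by as many forms as its codimension. -/
lemma exists_defining_forms (L : Submodule (ZMod 2) (Fin r → ZMod 2)) :
    ∃ b : Fin (Module.finrank (ZMod 2) ((Fin r → ZMod 2) ⧸ L)) → Fin r → ZMod 2,
      ∀ s, s ∈ L ↔ ∀ i, b i ⬝ᵥ s = 0 := by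
  let B := Module.finBasis (ZMod 2) ((Fin r → ZMod 2) ⧸ L)
  choose b hb using fun i => exists_dotProduct_eq (B.coord i ∘ₗ L.mkQ)
  refine ⟨b, fun s => ?_⟩
  simp only [hb, LinearMap.comp_apply]
  rw [B.forall_coord_eq_zero_iff, Submodule.mkQ_apply, Submodule.Quotient.mk_eq_zero]

/-- The points of a subspace are separated by as many forms as its dimension. -/
lemma exists_separating_forms (L : Submodule (ZMod 2) (Fin r → ZMod 2)) :
    ∃ b : Fin (Module.finrank (ZMod 2) L) → Fin r → ZMod 2,
      ∀ s ∈ L, (∀ i, b i ⬝ᵥ s = 0) → s = 0 := by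
  let B := Module.finBasis (ZMod 2) L
  choose φ hφ using fun i => LinearMap.exists_extend (B.coord i)
  choose b hb using fun i => exists_dotProduct_eq (φ i)
  refine ⟨b, fun s hs h => ?_⟩
  have h' : ∀ i, B.coord i ⟨s, hs⟩ = 0 := by
    intro i
    rw [← hφ i, ← h i, hb]
    rfl
  have := B.forall_coord_eq_zero_iff.1 h'
  simpa using this

open scoped Classical in
/-- The measurement of the sum of a linear function and of the indicator functions of the
cosets of `L` that contain the points `σ j`, `j ∈ S`. -/
lemma exists_coset_measurement {K : ℕ} (L : Submodule (ZMod 2) (Fin r → ZMod 2))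
    (hL : L ≠ ⊤) (v : Fin r → ZMod 2) (σ : Fin K → Fin r → ZMod 2) (S : Finset (Fin K)) :
    ∃ m : Measurement n, m.M = syndromeObservable hG
        (fun s => v ⬝ᵥ s + ∑ j ∈ S, if s + σ j ∈ L then 1 else 0) ∧
      twoQubitCount m.circuit = n + 2 * (Module.finrank (ZMod 2) ((Fin r → ZMod 2) ⧸ L)) * n +
        S.card * andCost (Module.finrank (ZMod 2) ((Fin r → ZMod 2) ⧸ L)) := by
  obtain ⟨b, hb⟩ := exists_defining_forms L
  have hρ : Module.finrank (ZMod 2) ((Fin r → ZMod 2) ⧸ L) ≠ 0 := by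
    intro h
    have := Module.finrank_zero_iff.1 h
    exact hL (Submodule.Quotient.subsingleton_iff.1 this)
  obtain ⟨m, hm, hm'⟩ := exists_pattern_measurement hG hρ v b
    (S.toList.map fun j i => b i ⬝ᵥ σ j)
  refine ⟨m, ?_, by rw [hm', List.length_map, Finset.length_toList]⟩
  rw [hm]
  congr 1
  funext s
  rw [List.map_map, Finset.sum_map_toList]
  congr 1
  refine Finset.sum_congr rfl fun j _ => ?_
  simp only [Function.comp_apply, hb, dotProduct_add]
  have h1 : ∀ x : ZMod 2, x ≠ 0 → x + 1 = 0 := by decide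
  split_ifs with h
  · simp [h]
  · push Not at h
    obtain ⟨i, hi⟩ := h
    exact Finset.prod_eq_zero (Finset.mem_univ i) (h1 _ hi)

end SyndromeMeasurements

/-! ### Syndromes of Pauli errors and the code space -/

section Errors

variable {n r : ℕ} {G : Fin r → Op (Fin n)} (hG : IsStabilizerGenerators G)

/-- The linear map from symplectic vectors to the syndromes of the corresponding Pauli
operators. -/
noncomputable def syndromeMap : (Fin n → ZMod 2 × ZMod 2) →ₗ[ZMod 2] (Fin r → ZMod 2) :=
  LinearMap.pi fun i => stringForm (isPauli_iff.1 (hG.pauli i)).choose_spec.choose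

/-- The syndrome of a Pauli string: the entry `i` tells whether it anticommutes with the `i`-th
stabilizer generator. -/
noncomputable def syndrome (u : Fin n → Pauli) : Fin r → ZMod 2 :=
  syndromeMap hG fun q => (u q).bits

lemma generator_mul_pauliOp (u : Fin n → Pauli) (i : Fin r) :
    G i * pauliOp u = sgn (syndrome hG u i) • (pauliOp u * G i) := by
  have h := (isPauli_iff.1 (hG.pauli i)).choose_spec.choose_spec
  set p := (isPauli_iff.1 (hG.pauli i)).choose_spec.choose with hp
  have hs : syndrome hG u i = stringForm p fun q => (u q).bits := rfl
  rw [h, hs, Matrix.smul_mul, pauliOp_mul_comm, Matrix.mul_smul, smul_comm]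

lemma pauliOp_mulVec_mem (u : Fin n → Pauli) {s : Fin r → ZMod 2} {ψ : Vec (Fin n)}
    (hψ : ψ ∈ syndromeSpace G s) : pauliOp u *ᵥ ψ ∈ syndromeSpace G (syndrome hG u + s) := by
  intro i
  rw [Matrix.mulVec_mulVec, generator_mul_pauliOp hG, Matrix.smul_mulVec, ← Matrix.mulVec_mulVec,
    hψ i, Matrix.mulVec_smul, smul_smul, Pi.add_apply, sgn_add]

lemma syndrome_eq_of_mem {s s' : Fin r → ZMod 2} {ψ : Vec (Fin n)} (hψ : ψ ∈ syndromeSpace G s)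
    (hψ' : ψ ∈ syndromeSpace G s') (h : ψ ≠ 0) : s = s' := by
  funext i
  apply sgn_injective
  have h' : (sgn (s i) - sgn (s' i)) • ψ = 0 := by rw [sub_smul, ← hψ i, ← hψ' i, sub_self]
  exact sub_eq_zero.1 ((smul_eq_zero.1 h').resolve_right h)

lemma add_self_bits {ι : Type*} (s : ι → ZMod 2) : s + s = 0 := by
  funext i
  exact CharTwo.add_self_eq_zero _

lemma add_eq_zero_bits {ι : Type*} {s s' : ι → ZMod 2} : s + s' = 0 ↔ s = s' := by
  refine ⟨fun h => ?_, fun h => h ▸ add_self_bits s⟩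
  rw [← add_zero s, ← add_self_bits s', ← add_assoc, h, zero_add]

lemma syndrome_identity : syndrome hG (fun _ => Pauli.I) = 0 := by
  rw [syndrome, ← map_zero (syndromeMap hG)]
  rfl

lemma pauliOp_mulVec_mulVec (u : Fin n → Pauli) (ψ : Vec (Fin n)) :
    pauliOp u *ᵥ (pauliOp u *ᵥ ψ) = ψ := by
  rw [Matrix.mulVec_mulVec, pauliOp_mul_self, Matrix.one_mulVec]

lemma pauliOp_mulVec_ne_zero (u : Fin n → Pauli) {ψ : Vec (Fin n)} (h : ψ ≠ 0) :
    pauliOp u *ᵥ ψ ≠ 0 := by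
  intro h'
  apply h
  rw [← pauliOp_mulVec_mulVec u ψ, h', Matrix.mulVec_zero]

lemma stabilizedSpace_eq : stabilizedSpace G = syndromeSpace G 0 := by
  ext ψ
  constructor
  · intro h i
    rw [Pi.zero_apply, sgn_zero, one_smul]
    exact h _ (Submonoid.subset_closure ⟨i, rfl⟩)
  · intro h S hS
    induction hS using Submonoid.closure_induction with
    | mem S hS =>
      obtain ⟨i, rfl⟩ := hS
      rw [h i, Pi.zero_apply, sgn_zero, one_smul]
    | one => exact Matrix.one_mulVec _
    | mul S T _ _ hS hT => rw [← Matrix.mulVec_mulVec, hT, hS]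

lemma map_translation_eq {T : Op (Fin n)} {c : ℂ} {u : Fin n → Pauli} (hc : c ≠ 0)
    (hT : T = c • pauliOp u) :
    (stabilizedSpace G).map (Matrix.toLin' T) = syndromeSpace G (syndrome hG u) := by
  rw [stabilizedSpace_eq]
  ext φ
  simp only [Submodule.mem_map, Matrix.toLin'_apply, hT, Matrix.smul_mulVec]
  constructor
  · rintro ⟨ψ, hψ, rfl⟩
    have := pauliOp_mulVec_mem hG u hψ
    rw [add_zero] at this
    exact Submodule.smul_mem _ _ this
  · intro hφ
    refine ⟨c⁻¹ • pauliOp u *ᵥ φ, Submodule.smul_mem _ _ ?_, ?_⟩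
    · have := pauliOp_mulVec_mem hG u hφ
      rwa [add_self_bits] at this
    · rw [Matrix.mulVec_smul, pauliOp_mulVec_mulVec, smul_smul, mul_inv_cancel₀ hc, one_smul]

/-- A union stabilizer code is a sum of joint eigenspaces for distinct syndromes of Pauli
strings. -/
lemma UStCode.exists_strings {n k K : ℕ} (C : UStCode n k K) :
    ∃ τ : Fin K → Fin n → Pauli,
      C.space = ⨆ j, syndromeSpace C.gen (syndrome C.isStabilizerGenerators (τ j)) ∧
      Function.Injective fun j => syndrome C.isStabilizerGenerators (τ j) := by
  choose m τ hτ using fun j => isPauli_iff.1 (C.translation_pauli j)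
  refine ⟨τ, ?_, fun i j hij => ?_⟩
  · rw [UStCode.space]
    congr 1
    funext j
    exact map_translation_eq _ (pow_ne_zero _ Complex.I_ne_zero) (hτ j)
  · by_contra hne
    apply C.inequivalent i j hne
    have hP := (C.translation_pauli i).conjTranspose.mul (C.translation_pauli j)
    refine ⟨hP, fun S hS => ?_⟩
    have hcomm : Commute S ((C.translation i)ᴴ * C.translation j) := by
      induction hS using Submonoid.closure_induction with
      | mem S hS =>
        obtain ⟨l, rfl⟩ := hS
        have hij' : syndrome C.isStabilizerGenerators (τ i) l =
            syndrome C.isStabilizerGenerators (τ j) l := congrFun hij l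
        rw [hτ, hτ, Matrix.conjTranspose_smul, pauliOp_conjTranspose, Matrix.smul_mul,
          Matrix.mul_smul]
        refine Commute.smul_right (Commute.smul_right ?_ _) _
        rw [Commute, SemiconjBy, ← mul_assoc, generator_mul_pauliOp C.isStabilizerGenerators,
          Matrix.smul_mul, mul_assoc, generator_mul_pauliOp C.isStabilizerGenerators,
          Matrix.mul_smul, smul_smul, hij', sgn_mul_self, one_smul, mul_assoc]
      | one => exact Commute.one_left _
      | mul S T _ _ hS hT => exact hS.mul_left hT
    rw [mul_assoc, hcomm.eq, ← mul_assoc, hP.conjTranspose_mul_self, one_mul]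

/-! ### Consequences of the error correction condition -/

/-- Two Pauli strings act in the same way on `Q`, up to a scalar. -/
def SameAction (Q : Submodule ℂ (Vec (Fin n))) (u u' : Fin n → Pauli) : Prop :=
  ∃ c : ℂ, ∀ ψ ∈ Q, pauliOp u *ᵥ ψ = c • pauliOp u' *ᵥ ψ

lemma SameAction.refl (Q : Submodule ℂ (Vec (Fin n))) (u : Fin n → Pauli) : SameAction Q u u :=
  ⟨1, fun _ _ => (one_smul _ _).symm⟩

lemma pauliOp_mem_pauliErrors {t : ℕ} {u : Fin n → Pauli} (hu : weight u ≤ t) :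
    pauliOp u ∈ pauliErrors n t := ⟨0, u, hu, by simp⟩

open scoped ComplexOrder in
/-- If a correctable operator maps a nonzero code state to a code state, it is a scalar on the
code: the constant in the error correction condition has modulus one, and equality holds in the
Cauchy-Schwarz inequality. -/
lemma IsErrorCorrecting.sameAction_of_mem {t : ℕ} {Q : Submodule ℂ (Vec (Fin n))}
    (hQ : IsErrorCorrecting t Q) {u u' : Fin n → Pauli} (hu : weight u ≤ t) (hu' : weight u' ≤ t)
    {ψ : Vec (Fin n)} (hψ : ψ ∈ Q) (h0 : ψ ≠ 0) (h : pauliOp u' *ᵥ (pauliOp u *ᵥ ψ) ∈ Q) :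
    SameAction Q u u' := by
  obtain ⟨c, hc⟩ := hQ _ (pauliOp_mem_pauliErrors hu') _ (pauliOp_mem_pauliErrors hu)
  rw [pauliOp_conjTranspose] at hc
  set F := pauliOp u' * pauliOp u with hF
  have hFF : Fᴴ * F = 1 := by
    rw [hF, Matrix.conjTranspose_mul, pauliOp_conjTranspose, pauliOp_conjTranspose, mul_assoc,
      ← mul_assoc (pauliOp u'), pauliOp_mul_self, one_mul, pauliOp_mul_self]
  have hnorm : ∀ φ, star (F *ᵥ φ) ⬝ᵥ (F *ᵥ φ) = star φ ⬝ᵥ φ := by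
    intro φ
    rw [Matrix.star_mulVec, Matrix.dotProduct_mulVec, Matrix.vecMul_vecMul, hFF, Matrix.vecMul_one]
  have hself : ∀ φ : Vec (Fin n), star (star φ ⬝ᵥ φ) = star φ ⬝ᵥ φ := fun φ =>
    (Matrix.star_dotProduct _ _).symm
  have hcc : c * star c = 1 := by
    have h1 := hc ψ hψ ψ hψ
    rw [Matrix.mulVec_mulVec, ← hF] at h
    have h2 := hc _ h ψ hψ
    rw [hnorm, Matrix.star_dotProduct (F *ᵥ ψ) ψ, h1, star_mul', hself] at h2
    have h3 : star ψ ⬝ᵥ ψ ≠ 0 := fun h => h0 (dotProduct_star_self_eq_zero.1 h)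
    have h4 : (c * star c - 1) * (star ψ ⬝ᵥ ψ) = 0 := by linear_combination -h2
    exact sub_eq_zero.1 ((mul_eq_zero.1 h4).resolve_right h3)
  refine ⟨c, fun φ hφ => ?_⟩
  have key : F *ᵥ φ = c • φ := by
    rw [← sub_eq_zero, ← dotProduct_star_self_eq_zero]
    have h1 := hc φ hφ φ hφ
    have h2 : star (F *ᵥ φ) ⬝ᵥ φ = star c * (star φ ⬝ᵥ φ) := by
      rw [Matrix.star_dotProduct, h1, star_mul', hself]
    rw [star_sub, star_smul, sub_dotProduct, dotProduct_sub, dotProduct_sub, hnorm,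
      dotProduct_smul, h2, smul_dotProduct, smul_dotProduct, dotProduct_smul, h1]
    simp only [smul_eq_mul]
    linear_combination (-(star φ ⬝ᵥ φ)) * hcc
  have h1 : pauliOp u *ᵥ φ = pauliOp u' *ᵥ (F *ᵥ φ) := by
    rw [hF, ← Matrix.mulVec_mulVec, pauliOp_mulVec_mulVec]
  rw [h1, key, Matrix.mulVec_smul]

/-- A scalar `e` cannot anticommute with `f` and commute with `f'` if `f` and `f'` act in the same
way on a nonzero code. -/
lemma false_of_sameAction {Q : Submodule ℂ (Vec (Fin n))} {e f f' : Fin n → Pauli}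
    {ψ : Vec (Fin n)} (hψ : ψ ∈ Q) (h0 : ψ ≠ 0) (he : SameAction Q e fun _ => Pauli.I)
    (hf : SameAction Q f f') (hef : stringForm e (fun q => (f q).bits) = 1)
    (hef' : stringForm e (fun q => (f' q).bits) = 0) : False := by
  obtain ⟨a, ha⟩ := he
  obtain ⟨c, hc⟩ := hf
  have ha' := ha ψ hψ
  rw [pauliOp_identity, Matrix.one_mulVec] at ha'
  have h1 : pauliOp e *ᵥ (pauliOp f *ᵥ ψ) = -(a • pauliOp f *ᵥ ψ) := by
    rw [Matrix.mulVec_mulVec, pauliOp_mul_comm, hef, sgn_one, Matrix.smul_mulVec,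
      ← Matrix.mulVec_mulVec, ha', Matrix.mulVec_smul, neg_smul, one_smul]
  have h2 : pauliOp e *ᵥ (pauliOp f *ᵥ ψ) = a • pauliOp f *ᵥ ψ := by
    rw [hc ψ hψ, Matrix.mulVec_smul, Matrix.mulVec_mulVec, pauliOp_mul_comm, hef', sgn_zero,
      one_smul, ← Matrix.mulVec_mulVec, ha', Matrix.mulVec_smul, smul_comm]
  have h3 : a • pauliOp f *ᵥ ψ ≠ 0 := by
    rw [← Matrix.mulVec_smul, ← ha']
    exact pauliOp_mulVec_ne_zero _ (pauliOp_mulVec_ne_zero _ h0)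
  exact h3 (self_eq_neg.1 (h2.symm.trans h1))

end Errors

/-! ### Decision trees of measurements -/

section Trees

variable {n : ℕ}

/-- The procedure corrects the Pauli strings in `Es` on the code `Q`. -/
def Recovery.CorrectsOn (r : Recovery n) (Q : Submodule ℂ (Vec (Fin n)))
    (Es : Set (Fin n → Pauli)) : Prop :=
  ∀ u ∈ Es, ∀ B ∈ r.branches, ∃ c : ℂ, ∀ ψ ∈ Q, B *ᵥ (pauliOp u *ᵥ ψ) = c • ψ

variable {Q : Submodule ℂ (Vec (Fin n))}

lemma Recovery.CorrectsOn.of_sameAction {r : Recovery n} {Es Es' : Set (Fin n → Pauli)}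
    (h : r.CorrectsOn Q Es) (h' : ∀ u ∈ Es', ∃ u' ∈ Es, SameAction Q u u') :
    r.CorrectsOn Q Es' := by
  intro u hu B hB
  obtain ⟨u', hu', a, ha⟩ := h' u hu
  obtain ⟨c, hc⟩ := h u' hu' B hB
  refine ⟨a * c, fun ψ hψ => ?_⟩
  rw [ha ψ hψ, Matrix.mulVec_smul, hc ψ hψ, smul_smul]

lemma Recovery.exists_correct {Es : Set (Fin n → Pauli)}
    (h : ∀ u ∈ Es, ∀ u' ∈ Es, SameAction Q u u') :
    ∃ p, (Recovery.correct p).CorrectsOn Q Es := by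
  rcases Es.eq_empty_or_nonempty with rfl | ⟨p, hp⟩
  · exact ⟨fun _ => .I, fun u hu => hu.elim⟩
  · refine ⟨p, fun u hu B hB => ?_⟩
    rw [Recovery.branches, List.mem_singleton] at hB
    subst hB
    obtain ⟨c, hc⟩ := h u hu p hp
    refine ⟨c, fun ψ hψ => ?_⟩
    rw [hc ψ hψ, Matrix.mulVec_smul, pauliOp_mulVec_mulVec]

/-- The outcome `x u` of the measurement is determined by the error `u ∈ Es`, and the measurement
does not disturb the state. -/
def Measurement.Detects (m : Measurement n) (Q : Submodule ℂ (Vec (Fin n)))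
    (Es : Set (Fin n → Pauli)) (x : (Fin n → Pauli) → ZMod 2) : Prop :=
  ∀ u ∈ Es, ∀ ψ ∈ Q, m.M *ᵥ (pauliOp u *ᵥ ψ) = sgn (x u) • pauliOp u *ᵥ ψ

lemma Recovery.CorrectsOn.measure {m : Measurement n} {r s : Recovery n}
    {Es : Set (Fin n → Pauli)} {x : (Fin n → Pauli) → ZMod 2} (hm : m.Detects Q Es x)
    (hr : r.CorrectsOn Q {u ∈ Es | x u = 0}) (hs : s.CorrectsOn Q {u ∈ Es | x u = 1}) :
    (Recovery.measure m r s).CorrectsOn Q Es := by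
  intro u hu B hB
  have h2 : ∀ φ : Vec (Fin n), (1 / 2 : ℂ) • (φ + φ) = φ := fun φ => by module
  rw [Recovery.branches, List.mem_append, List.mem_map, List.mem_map] at hB
  rcases hB with ⟨B, hB, rfl⟩ | ⟨B, hB, rfl⟩
  · rcases zmod_two_cases (x u) with hx | hx
    · obtain ⟨c, hc⟩ := hr u ⟨hu, hx⟩ B hB
      refine ⟨c, fun ψ hψ => ?_⟩
      rw [← hc ψ hψ, ← Matrix.mulVec_mulVec, Measurement.plus, Matrix.smul_mulVec,
        Matrix.add_mulVec, hm u hu ψ hψ, hx, sgn_zero, one_smul, Matrix.one_mulVec, h2]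
    · refine ⟨0, fun ψ hψ => ?_⟩
      rw [← Matrix.mulVec_mulVec, Measurement.plus, Matrix.smul_mulVec,
        Matrix.add_mulVec, hm u hu ψ hψ, hx, sgn_one, neg_smul, one_smul, Matrix.one_mulVec,
        add_neg_cancel, smul_zero, Matrix.mulVec_zero, zero_smul]
  · rcases zmod_two_cases (x u) with hx | hx
    · refine ⟨0, fun ψ hψ => ?_⟩
      rw [← Matrix.mulVec_mulVec, Measurement.minus, Matrix.smul_mulVec,
        Matrix.sub_mulVec, hm u hu ψ hψ, hx, sgn_zero, one_smul, Matrix.one_mulVec,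
        sub_self, smul_zero, Matrix.mulVec_zero, zero_smul]
    · obtain ⟨c, hc⟩ := hs u ⟨hu, hx⟩ B hB
      refine ⟨c, fun ψ hψ => ?_⟩
      rw [← hc ψ hψ, ← Matrix.mulVec_mulVec, Measurement.minus, Matrix.smul_mulVec,
        Matrix.sub_mulVec, hm u hu ψ hψ, hx, sgn_one, neg_smul, one_smul, Matrix.one_mulVec,
        sub_neg_eq_add, h2]

/-- Measurements that together identify the errors in `Es` up to their action on the code can be
performed one after the other. -/
lemma exists_recovery_of_detects (P : Measurement n → Prop) (N : ℕ) :
    ∀ (Es : Set (Fin n → Pauli)) (m : Fin N → Measurement n)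
      (x : Fin N → (Fin n → Pauli) → ZMod 2), (∀ i, P (m i)) → (∀ i, (m i).Detects Q Es (x i)) →
      (∀ u ∈ Es, ∀ u' ∈ Es, (∀ i, x i u = x i u') → SameAction Q u u') →
      ∃ r : Recovery n, r.depth ≤ N ∧ (∀ m ∈ r.measurements, P m) ∧ r.CorrectsOn Q Es := by
  induction N with
  | zero =>
    intro Es m x _ _ h
    obtain ⟨p, hp⟩ := Recovery.exists_correct fun u hu u' hu' => h u hu u' hu' fun i => i.elim0
    exact ⟨.correct p, le_rfl, fun m hm => by simp [Recovery.measurements] at hm, hp⟩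
  | succ N ih =>
    intro Es m x hP hm h
    have key : ∀ y : ZMod 2, ∃ r : Recovery n, r.depth ≤ N ∧ (∀ m ∈ r.measurements, P m) ∧
        r.CorrectsOn Q {u ∈ Es | x 0 u = y} := fun y =>
      ih {u ∈ Es | x 0 u = y} (fun i => m i.succ) (fun i => x i.succ) (fun i => hP _)
        (fun i u hu => hm i.succ u hu.1)
        fun u hu u' hu' hx => h u hu.1 u' hu'.1 (Fin.cases (hu.2.trans hu'.2.symm) hx)
    obtain ⟨r, hr, hrP, hrc⟩ := key 0
    obtain ⟨s, hs, hsP, hsc⟩ := key 1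
    refine ⟨.measure (m 0) r s, ?_, ?_, .measure (hm 0) hrc hsc⟩
    · rw [Recovery.depth]
      omega
    · intro m' hm'
      rw [Recovery.measurements, List.mem_cons, List.mem_append] at hm'
      rcases hm' with rfl | h | h
      · exact hP 0
      · exact hrP _ h
      · exact hsP _ h

end Trees

/-! ### Errors supported on a given set of qubits -/

section Local

variable {n r : ℕ} {G : Fin r → Op (Fin n)} (hG : IsStabilizerGenerators G)

/-- The Pauli string `u` acts trivially outside of `A`. -/
def SupportedOn (A : Finset (Fin n)) (u : Fin n → Pauli) : Prop := ∀ q ∉ A, u q = Pauli.I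

lemma SupportedOn.weight_le {A : Finset (Fin n)} {u : Fin n → Pauli} (h : SupportedOn A u) :
    weight u ≤ A.card := by
  refine Finset.card_le_card fun q hq => ?_
  by_contra hA
  exact (Finset.mem_filter.1 hq).2 (h q hA)

lemma exists_supportedOn {t : ℕ} (ht : t ≤ n) {u : Fin n → Pauli} (hu : weight u ≤ t) :
    ∃ A : Finset (Fin n), A.card = t ∧ SupportedOn A u := by
  obtain ⟨A, hA, hcard⟩ := Finset.exists_superset_card_eq
    (s := Finset.univ.filter fun q => u q ≠ Pauli.I) hu (by simpa using ht)
  refine ⟨A, hcard, fun q hq => ?_⟩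
  by_contra h
  exact hq (hA (Finset.mem_filter.2 ⟨Finset.mem_univ q, h⟩))

/-- The extension by zero of symplectic vectors on `A`. -/
def extendZero (A : Finset (Fin n)) :
    (A → ZMod 2 × ZMod 2) →ₗ[ZMod 2] (Fin n → ZMod 2 × ZMod 2) :=
  LinearMap.pi fun q => if h : q ∈ A then LinearMap.proj ⟨q, h⟩ else 0

/-- The syndromes of the Pauli strings supported on `A`. -/
noncomputable def localSyndromes (A : Finset (Fin n)) : Submodule (ZMod 2) (Fin r → ZMod 2) :=
  LinearMap.range (syndromeMap hG ∘ₗ extendZero A)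

lemma mem_localSyndromes {A : Finset (Fin n)} {s : Fin r → ZMod 2} :
    s ∈ localSyndromes hG A ↔ ∃ u, SupportedOn A u ∧ syndrome hG u = s := by
  constructor
  · rintro ⟨w, rfl⟩
    refine ⟨fun q => Pauli.ofBits (extendZero A w q), fun q hq => ?_, ?_⟩
    · change Pauli.ofBits (extendZero A w q) = .I
      rw [extendZero, LinearMap.pi_apply, dif_neg hq, LinearMap.zero_apply, Pauli.ofBits_zero]
    · simp only [syndrome, Pauli.bits_ofBits, LinearMap.comp_apply]
  · rintro ⟨u, hu, rfl⟩
    refine ⟨fun q => (u q).bits, ?_⟩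
    rw [LinearMap.comp_apply, syndrome]
    congr 1
    funext q
    rw [extendZero, LinearMap.pi_apply]
    split_ifs with h
    · rfl
    · rw [hu q h]
      rfl

lemma finrank_localSyndromes_le (A : Finset (Fin n)) :
    Module.finrank (ZMod 2) (localSyndromes hG A) ≤ 2 * A.card := by
  refine (LinearMap.finrank_range_le _).trans ?_
  rw [Module.finrank_pi_fintype]
  simp [mul_comm]

/-- The Pauli string with the label `a` at the qubit `q`. -/
def singleString (q : Fin n) (a : Pauli) : Fin n → Pauli := fun l => if l = q then a else .I

lemma supportedOn_singleString (q : Fin n) (a : Pauli) : SupportedOn {q} (singleString q a) :=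
  fun l hl => if_neg (by simpa using hl)

lemma weight_singleString_le (q : Fin n) (a : Pauli) : weight (singleString q a) ≤ 1 :=
  (supportedOn_singleString q a).weight_le

lemma stringForm_singleString_same (q : Fin n) (a b : Pauli) :
    stringForm (singleString q a) (fun l => (singleString q b l).bits) = a.form b.bits := by
  rw [stringForm_apply, Finset.sum_eq_single q]
  · simp [singleString]
  · intro l _ hl
    simp [singleString, hl, Pauli.form_apply, Pauli.bits]
  · simp

lemma stringForm_singleString_of_ne {q q' : Fin n} (h : q ≠ q') (a b : Pauli) :
    stringForm (singleString q a) (fun l => (singleString q' b l).bits) = 0 := by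
  rw [stringForm_apply]
  refine Finset.sum_eq_zero fun l _ => ?_
  by_cases hl : l = q
  · subst hl
    simp [singleString, h, Pauli.form_apply, Pauli.bits]
  · simp [singleString, hl, Pauli.form_apply, Pauli.bits]

lemma stringForm_identity (u : Fin n → Pauli) :
    stringForm u (fun _ => Pauli.I.bits) = 0 := map_zero (stringForm u)

lemma syndrome_singleString_Y (q : Fin n) : syndrome hG (singleString q .Y) =
    syndrome hG (singleString q .X) + syndrome hG (singleString q .Z) := by
  rw [syndrome, syndrome, syndrome, ← map_add]
  congr 1
  funext l
  by_cases hl : l = q <;> simp [singleString, hl, Pauli.bits]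

end Local

/-! ### Recovery for union stabilizer codes -/

section Recovery

variable {n r K t : ℕ} {G : Fin r → Op (Fin n)}

lemma weight_identity_le : weight (fun _ : Fin n => Pauli.I) ≤ t := by simp [weight]

/-- A nonzero `t`-error correcting code that is a sum of joint eigenspaces of the stabilizer
generators, for distinct syndromes of the Pauli strings `τ j`. -/
structure IsShiftedCode (hG : IsStabilizerGenerators G) (t : ℕ) (τ : Fin K → Fin n → Pauli)
    (Q : Submodule ℂ (Vec (Fin n))) : Prop where
  eq_iSup : Q = ⨆ j, syndromeSpace G (syndrome hG (τ j))
  injective : Function.Injective fun j => syndrome hG (τ j)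
  correcting : IsErrorCorrecting t Q
  ne_bot : Q ≠ ⊥

namespace IsShiftedCode

variable {hG : IsStabilizerGenerators G} {τ : Fin K → Fin n → Pauli}
  {Q : Submodule ℂ (Vec (Fin n))} (hQ : IsShiftedCode hG t τ Q)

include hQ

lemma le (j : Fin K) : syndromeSpace G (syndrome hG (τ j)) ≤ Q := by
  rw [hQ.eq_iSup]
  exact le_iSup (fun j => syndromeSpace G (syndrome hG (τ j))) j

lemma exists_index : ∃ j, syndromeSpace G (syndrome hG (τ j)) ≠ ⊥ := by
  by_contra! h
  exact hQ.ne_bot (by rw [hQ.eq_iSup]; simp [h])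

lemma exists_ne_zero (j : Fin K) : ∃ ψ ∈ syndromeSpace G (syndrome hG (τ j)), ψ ≠ 0 := by
  obtain ⟨i, hi⟩ := hQ.exists_index
  obtain ⟨ψ, hψ, h0⟩ := (Submodule.ne_bot_iff _).1 hi
  refine ⟨pauliOp (τ j) *ᵥ (pauliOp (τ i) *ᵥ ψ), ?_,
    pauliOp_mulVec_ne_zero _ (pauliOp_mulVec_ne_zero _ h0)⟩
  have := pauliOp_mulVec_mem hG (τ j) (pauliOp_mulVec_mem hG (τ i) hψ)
  rwa [add_self_bits, add_zero] at this

/-- If two correctable errors map some pair of components of the code to the same joint eigenspace,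
then they act in the same way, and the components agree. -/
lemma sameAction_of_syndrome {u u' : Fin n → Pauli} (hu : weight u ≤ t) (hu' : weight u' ≤ t)
    {i j : Fin K} (h : syndrome hG u + syndrome hG (τ j) = syndrome hG u' + syndrome hG (τ i)) :
    SameAction Q u u' ∧ i = j := by
  obtain ⟨ψ, hψ, h0⟩ := hQ.exists_ne_zero j
  have hmem := pauliOp_mulVec_mem hG u' (pauliOp_mulVec_mem hG u hψ)
  rw [h, ← add_assoc, add_self_bits, zero_add] at hmem
  have hsame := hQ.correcting.sameAction_of_mem hu hu' (hQ.le j hψ) h0 (hQ.le i hmem)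
  refine ⟨hsame, hQ.injective ?_⟩
  obtain ⟨c, hc⟩ := hsame
  rw [hc ψ (hQ.le j hψ), Matrix.mulVec_smul, pauliOp_mulVec_mulVec] at hmem
  have hc0 : c ≠ 0 := by
    rintro rfl
    apply pauliOp_mulVec_ne_zero u h0
    rw [hc ψ (hQ.le j hψ), zero_smul]
  exact syndrome_eq_of_mem ((Submodule.smul_mem_iff _ hc0).1 hmem) hψ h0

lemma sameAction_identity {u : Fin n → Pauli} (hu : weight u ≤ t) (h : syndrome hG u = 0) :
    SameAction Q u fun _ => Pauli.I := by
  obtain ⟨j, _⟩ := hQ.exists_index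
  exact (hQ.sameAction_of_syndrome hu weight_identity_le
    (i := j) (j := j) (by rw [h, syndrome_identity])).1

lemma exists_mem_ne_zero : ∃ ψ ∈ Q, ψ ≠ 0 := (Submodule.ne_bot_iff _).1 hQ.ne_bot

/-- An observable that takes the value `(-1)^x` on all components of the code after the error `u`
is constant on the corrupted code. -/
lemma syndromeObservable_mulVec_pauliOp (f : (Fin r → ZMod 2) → ZMod 2) {u : Fin n → Pauli}
    {x : ZMod 2} (h : ∀ j, f (syndrome hG u + syndrome hG (τ j)) = x) {ψ : Vec (Fin n)}
    (hψ : ψ ∈ Q) :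
    syndromeObservable hG f *ᵥ (pauliOp u *ᵥ ψ) = sgn x • pauliOp u *ᵥ ψ := by
  rw [hQ.eq_iSup] at hψ
  induction hψ using Submodule.iSup_induction' with
  | mem j ψ hψ => rw [syndromeObservable_mulVec hG f (pauliOp_mulVec_mem hG u hψ), h j]
  | zero => simp
  | add ψ φ _ _ hψ hφ => rw [Matrix.mulVec_add, Matrix.mulVec_add, hψ, hφ, smul_add]

/-! ### Dimension bounds from the error correction condition -/

/-- Two anticommuting errors cannot both have trivial syndrome. -/
lemma localSyndromes_ne_bot (ht : 1 ≤ t) {A : Finset (Fin n)} (hA : A.Nonempty) :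
    localSyndromes hG A ≠ ⊥ := by
  intro h
  obtain ⟨q, hq⟩ := hA
  have hs : ∀ a, syndrome hG (singleString q a) = 0 := by
    intro a
    rw [← Submodule.mem_bot (R := ZMod 2), ← h, mem_localSyndromes]
    refine ⟨_, fun l hl => supportedOn_singleString q a l ?_, rfl⟩
    rintro hl'
    rw [Finset.mem_singleton.1 hl'] at hl
    exact hl hq
  have hw : ∀ a, weight (singleString q a) ≤ t := fun a => (weight_singleString_le q a).trans ht
  obtain ⟨ψ, hψ, h0⟩ := hQ.exists_mem_ne_zero
  refine false_of_sameAction hψ h0 (hQ.sameAction_identity (hw .X) (hs _))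
    (hQ.sameAction_identity (hw .Z) (hs _)) ?_ (stringForm_identity _)
  rw [stringForm_singleString_same]
  simp [Pauli.form_apply, Pauli.bits]

/-- Cosets of distinct components modulo local syndromes are distinct. -/
lemma eq_of_add_mem_localSyndromes {A : Finset (Fin n)} (hA : A.card ≤ t) {i j : Fin K}
    (h : syndrome hG (τ j) + syndrome hG (τ i) ∈ localSyndromes hG A) : i = j := by
  obtain ⟨u, hu, hs⟩ := (mem_localSyndromes hG).1 h
  refine (hQ.sameAction_of_syndrome (hu.weight_le.trans hA) weight_identity_le ?_).2
  rw [hs, syndrome_identity, add_right_comm, add_self_bits]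

lemma localSyndromes_ne_top (hK : 2 ≤ K) {A : Finset (Fin n)} (hA : A.card ≤ t) :
    localSyndromes hG A ≠ ⊤ := by
  intro h
  have := hQ.eq_of_add_mem_localSyndromes hA (i := ⟨0, by omega⟩) (j := ⟨1, by omega⟩)
    (by rw [h]; trivial)
  simp at this

/-- With at most one stabilizer generator, each qubit has an undetectable nontrivial error `e q` and
a detectable error `f q` that anticommutes with it. The products `f q * f q'` are then
undetectable. -/
lemma two_le_generators (ht : 1 ≤ t) (hn : 2 ≤ n) : 2 ≤ r := by
  by_contra! hr
  have hcases : ∀ s : Fin r → ZMod 2, s = 0 ∨ s = 1 := by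
    intro s
    have : Subsingleton (Fin r) := Fin.subsingleton_iff_le_one.2 (by omega)
    rcases isEmpty_or_nonempty (Fin r) with h | ⟨⟨i⟩⟩
    · exact Or.inl (Subsingleton.elim _ _)
    · rcases zmod_two_cases (s i) with h | h
      · left; funext i'; rw [Subsingleton.elim i' i, h]; rfl
      · right; funext i'; rw [Subsingleton.elim i' i, h]; rfl
  have hw : ∀ (q : Fin n) a, weight (singleString q a) ≤ t := fun q a =>
    (weight_singleString_le q a).trans ht
  have hef : ∀ q : Fin n, ∃ e f : Pauli, syndrome hG (singleString q e) = 0 ∧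
      e.form f.bits = 1 := by
    intro q
    rcases hcases (syndrome hG (singleString q .X)) with hX | hX
    · exact ⟨.X, .Z, hX, by simp [Pauli.form_apply, Pauli.bits]⟩
    rcases hcases (syndrome hG (singleString q .Z)) with hZ | hZ
    · exact ⟨.Z, .X, hZ, by simp [Pauli.form_apply, Pauli.bits]⟩
    · exact ⟨.Y, .X, by rw [syndrome_singleString_Y, hX, hZ, add_self_bits],
        by simp [Pauli.form_apply, Pauli.bits]⟩
  choose e f he hf using hef
  obtain ⟨ψ, hψ, h0⟩ := hQ.exists_mem_ne_zero
  have hf1 : ∀ q, syndrome hG (singleString q (f q)) = 1 := by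
    intro q
    refine (hcases _).resolve_left fun h => ?_
    refine false_of_sameAction hψ h0 (hQ.sameAction_identity (hw q _) (he q))
      (hQ.sameAction_identity (hw q _) h) ?_ (stringForm_identity _)
    rw [stringForm_singleString_same, hf]
  obtain ⟨j, _⟩ := hQ.exists_index
  let q : Fin n := ⟨0, by omega⟩
  let q' : Fin n := ⟨1, by omega⟩
  have hqq : q ≠ q' := by simp [q, q']
  have hsame := (hQ.sameAction_of_syndrome (hw q (f q)) (hw q' (f q')) (i := j) (j := j)
    (by rw [hf1, hf1])).1
  refine false_of_sameAction hψ h0 (hQ.sameAction_identity (hw q _) (he q)) hsame ?_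
    (stringForm_singleString_of_ne hqq _ _)
  rw [stringForm_singleString_same, hf]

end IsShiftedCode

/-! ### Counting gates and measurements -/

/-- The gates for `K` cosets of codimension `ρ` fit into the budget; the difference is smallest for
`K = 2` and `n = ρ + 1`. -/
lemma cost_le {n R ρ K : ℕ} (hK : 2 ≤ K) (hρ : ρ ≠ 0) (hρR : ρ ≤ R) (hR : R + 1 ≤ n) :
    n + 2 * ρ * n + K * andCost ρ ≤ 2 * K * (n + 1) * R := by
  refine le_trans ?_ (Nat.mul_le_mul_left _ hρR)
  rcases eq_or_ne ρ 1 with rfl | h1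
  · rw [andCost, if_pos rfl]
    nlinarith
  · obtain ⟨m, rfl⟩ : ∃ m, ρ = m + 2 := ⟨ρ - 2, by omega⟩
    obtain ⟨κ, rfl⟩ : ∃ κ, K = κ + 2 := ⟨K - 2, by omega⟩
    obtain ⟨ν, rfl⟩ : ∃ ν, n = m + 3 + ν := ⟨n - (m + 3), by omega⟩
    rw [andCost, if_neg h1, Nat.add_sub_cancel]
    have h2 : 7 * m ≤ 2 * m * m + 7 := by
      rcases le_or_gt m 1 with h | h
      · omega
      · zify at *; nlinarith [sq_nonneg ((m : ℤ) - 2)]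
    nlinarith [Nat.zero_le (m * ν), Nat.zero_le (κ * (m * m)), Nat.zero_le (κ * m * ν),
      Nat.zero_le (κ * ν), Nat.zero_le ν, Nat.mul_le_mul_left κ h2, Nat.zero_le κ]

lemma succ_le_choose_add {n t : ℕ} (ht : 1 ≤ t) (htn : t ≤ n) : n + 1 ≤ n.choose t + t := by
  induction n generalizing t with
  | zero => omega
  | succ n ih =>
    obtain ⟨t, rfl⟩ : ∃ m, t = m + 1 := ⟨t - 1, by omega⟩
    rcases eq_or_lt_of_le htn with h | h
    · rw [h, Nat.choose_self]; omega
    · have h1 := ih (t := t + 1) (by omega) (by omega)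
      have h2 : 0 < n.choose t := Nat.choose_pos (by omega)
      rw [Nat.choose_succ_succ']
      omega

/-! ### Locating and identifying the error -/

namespace IsShiftedCode

variable {hG : IsStabilizerGenerators G} {τ : Fin K → Fin n → Pauli}
  {Q : Submodule ℂ (Vec (Fin n))} (hQ : IsShiftedCode hG t τ Q)

include hQ

/-- The codimension of the local syndromes is at most `r - 1`, so that measurements depending only
on the coset of the syndrome are cheap. -/
lemma coset_cost_le (hK : 2 ≤ K) (ht : 1 ≤ t) (hr : r ≤ n) {A : Finset (Fin n)}
    (hA : A.card = t) (S : Finset (Fin K)) :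
    n + 2 * Module.finrank (ZMod 2) ((Fin r → ZMod 2) ⧸ localSyndromes hG A) * n + S.card *
      andCost (Module.finrank (ZMod 2) ((Fin r → ZMod 2) ⧸ localSyndromes hG A)) ≤
      2 * K * (n + 1) * (r - 1) := by
  have h1 := (localSyndromes hG A).finrank_quotient_add_finrank
  rw [Module.finrank_fin_fun] at h1
  have h2 : Module.finrank (ZMod 2) (localSyndromes hG A) ≠ 0 := fun h =>
    hQ.localSyndromes_ne_bot ht (Finset.card_pos.1 (by omega)) (Submodule.finrank_eq_zero.1 h)
  have h3 : Module.finrank (ZMod 2) ((Fin r → ZMod 2) ⧸ localSyndromes hG A) ≠ 0 := fun h =>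
    hQ.localSyndromes_ne_top hK hA.le
      (Submodule.Quotient.subsingleton_iff.1 (Module.finrank_zero_iff.1 h))
  have hS : S.card ≤ K := by simpa using Finset.card_le_univ S
  exact (Nat.add_le_add_left (Nat.mul_le_mul_right _ hS) _).trans
    (cost_le hK h3 (by omega) (by omega))

/-- For errors on a known set `A` of `t` qubits, the linear forms on the local syndromes can be
measured although the component of the code is unknown: the coset of the syndrome modulo the local
syndromes determines the component, and with it the required correction of the form. -/
lemma exists_local_recovery (hK : 2 ≤ K) (ht : 1 ≤ t) (hr : r ≤ n) {A : Finset (Fin n)}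
    (hA : A.card = t) : ∃ R : Recovery n, R.depth ≤ 2 * t ∧
      (∀ m ∈ R.measurements, twoQubitCount m.circuit ≤ 2 * K * (n + 1) * (r - 1)) ∧
      R.CorrectsOn Q {u | SupportedOn A u} := by
  classical
  set L := localSyndromes hG A with hL
  obtain ⟨b, hb⟩ := exists_separating_forms L
  have hLtop : L ≠ ⊤ := hQ.localSyndromes_ne_top hK hA.le
  choose m hm hcost using fun i => exists_coset_measurement hG L hLtop (b i)
    (fun j => syndrome hG (τ j)) (Finset.univ.filter fun j => b i ⬝ᵥ syndrome hG (τ j) = 1)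
  have hdet : ∀ i, (m i).Detects Q {u | SupportedOn A u} fun u => b i ⬝ᵥ syndrome hG u := by
    intro i u hu ψ hψ
    rw [hm]
    refine hQ.syndromeObservable_mulVec_pauliOp _ (fun j => ?_) hψ
    have hsu : syndrome hG u ∈ L := (mem_localSyndromes hG).2 ⟨u, hu, rfl⟩
    have hmem : ∀ i', (syndrome hG u + syndrome hG (τ j) + syndrome hG (τ i') ∈ L) ↔ j = i' := by
      intro i'
      rw [add_assoc, Submodule.add_mem_iff_right _ hsu]
      constructor
      · intro h
        exact (hQ.eq_of_add_mem_localSyndromes hA.le h).symm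
      · rintro rfl
        rw [add_self_bits]
        exact L.zero_mem
    simp only [hmem]
    rw [Finset.sum_ite_eq, dotProduct_add, add_assoc]
    convert! add_zero _
    rcases zmod_two_cases (b i ⬝ᵥ syndrome hG (τ j)) with h | h <;>
      simp [h, CharTwo.add_self_eq_zero]
  have hsep : ∀ u ∈ {u | SupportedOn A u}, ∀ u' ∈ {u | SupportedOn A u},
      (∀ i, b i ⬝ᵥ syndrome hG u = b i ⬝ᵥ syndrome hG u') → SameAction Q u u' := by
    intro u hu u' hu' h
    obtain ⟨j, _⟩ := hQ.exists_index
    refine (hQ.sameAction_of_syndrome (hu.weight_le.trans hA.le) (hu'.weight_le.trans hA.le)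
      (i := j) (j := j) ?_).1
    congr 1
    rw [← add_eq_zero_bits]
    refine hb _ (L.add_mem ((mem_localSyndromes hG).2 ⟨u, hu, rfl⟩)
      ((mem_localSyndromes hG).2 ⟨u', hu', rfl⟩)) fun i => ?_
    rw [dotProduct_add, h i, CharTwo.add_self_eq_zero]
  obtain ⟨R, hR, hRcost, hRc⟩ := exists_recovery_of_detects (Q := Q)
    (fun m => twoQubitCount m.circuit ≤ 2 * K * (n + 1) * (r - 1)) _ {u | SupportedOn A u} m
    (fun i u => b i ⬝ᵥ syndrome hG u)
    (fun i => (hcost i).trans_le (hQ.coset_cost_le hK ht hr hA _)) hdet hsep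
  refine ⟨R, hR.trans ?_, hRcost, hRc⟩
  rw [← hA]
  exact finrank_localSyndromes_le hG A

open scoped Classical in
/-- The measurement that decides whether the error is equivalent to one supported on `A`. -/
lemma exists_support_measurement (hK : 2 ≤ K) (ht : 1 ≤ t) (hr : r ≤ n) {A : Finset (Fin n)}
    (hA : A.card = t) :
    ∃ m : Measurement n, twoQubitCount m.circuit ≤ 2 * K * (n + 1) * (r - 1) ∧
      m.Detects Q {u | weight u ≤ t}
        fun u => if ∃ u', SupportedOn A u' ∧ SameAction Q u u' then 1 else 0 := by
  obtain ⟨m, hm, hcost⟩ := exists_coset_measurement hG (localSyndromes hG A)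
    (hQ.localSyndromes_ne_top hK hA.le) 0 (fun j => syndrome hG (τ j)) Finset.univ
  refine ⟨m, hcost.trans_le (hQ.coset_cost_le hK ht hr hA _), fun u hu ψ hψ => ?_⟩
  rw [hm]
  simp only
  split_ifs with h
  · obtain ⟨u', hu', c, hc⟩ := h
    rw [hc ψ hψ, Matrix.mulVec_smul, smul_comm]
    congr 1
    refine hQ.syndromeObservable_mulVec_pauliOp _ (fun j => ?_) hψ
    have hsu : syndrome hG u' ∈ localSyndromes hG A := (mem_localSyndromes hG).2 ⟨u', hu', rfl⟩
    have hmem : ∀ i', (syndrome hG u' + syndrome hG (τ j) + syndrome hG (τ i') ∈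
        localSyndromes hG A) ↔ j = i' := by
      intro i'
      rw [add_assoc, Submodule.add_mem_iff_right _ hsu]
      constructor
      · intro h
        exact (hQ.eq_of_add_mem_localSyndromes hA.le h).symm
      · rintro rfl
        rw [add_self_bits]
        exact Submodule.zero_mem _
    simp [hmem]
  · refine hQ.syndromeObservable_mulVec_pauliOp _ (fun j => ?_) hψ
    rw [zero_dotProduct, zero_add]
    refine Finset.sum_eq_zero fun i _ => if_neg fun hmem => h ?_
    obtain ⟨u', hu', hs⟩ := (mem_localSyndromes hG).1 hmem
    refine ⟨u', hu', (hQ.sameAction_of_syndrome hu (hu'.weight_le.trans hA.le)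
      (i := i) (j := j) ?_).1⟩
    rw [hs, add_assoc, add_self_bits, add_zero]

/-- The sets in the list `l` are tested one after the other, except for the last one. -/
lemma exists_list_recovery (hK : 2 ≤ K) (ht : 1 ≤ t) (hr : r ≤ n) :
    ∀ l : List (Finset (Fin n)), l ≠ [] → (∀ A ∈ l, A.card = t) →
      ∃ R : Recovery n, R.depth + 1 ≤ l.length + 2 * t ∧
        (∀ m ∈ R.measurements, twoQubitCount m.circuit ≤ 2 * K * (n + 1) * (r - 1)) ∧
        R.CorrectsOn Q {u | weight u ≤ t ∧
          ∃ A ∈ l, ∃ u', SupportedOn A u' ∧ SameAction Q u u'} := by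
  classical
  intro l
  induction l with
  | nil => intro h; exact absurd rfl h
  | cons A l ih =>
    intro _ hl
    have hA : A.card = t := hl A List.mem_cons_self
    obtain ⟨R, hR, hRcost, hRc⟩ := hQ.exists_local_recovery hK ht hr hA
    rcases eq_or_ne l [] with rfl | hne
    · refine ⟨R, by simp only [List.length_singleton]; omega, hRcost, hRc.of_sameAction ?_⟩
      rintro u ⟨_, A', hA', u', hu', hsame⟩
      rw [List.mem_singleton] at hA'
      subst hA'
      exact ⟨u', hu', hsame⟩
    · obtain ⟨R', hR', hRcost', hRc'⟩ := ih hne fun A hA => hl A (List.mem_cons_of_mem _ hA)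
      obtain ⟨m, hm, hdet⟩ := hQ.exists_support_measurement hK ht hr hA
      refine ⟨.measure m R' R, ?_, ?_, Recovery.CorrectsOn.measure
        (fun u hu => hdet u hu.1) (hRc'.of_sameAction ?_) (hRc.of_sameAction ?_)⟩
      · have := List.length_pos_iff.2 hne
        rw [Recovery.depth, List.length_cons]
        omega
      · intro m' hm'
        rw [Recovery.measurements, List.mem_cons, List.mem_append] at hm'
        rcases hm' with rfl | h | h
        · exact hm
        · exact hRcost' _ h
        · exact hRcost _ h
      · rintro u ⟨⟨hu, A', hA', h⟩, hx⟩
        refine ⟨u, ⟨hu, A', ?_, h⟩, SameAction.refl _ _⟩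
        rcases List.mem_cons.1 hA' with rfl | h'
        · rw [if_pos h] at hx
          exact absurd hx one_ne_zero
        · exact h'
      · rintro u ⟨_, hx⟩
        by_cases h : ∃ u', SupportedOn A u' ∧ SameAction Q u u'
        · exact h
        · rw [if_neg h] at hx
          exact absurd hx zero_ne_one

/-- For a stabilizer code, measuring the generators suffices. -/
lemma exists_recovery_of_eq_one (hK : K = 1) :
    ∃ R : Recovery n, R.depth ≤ r ∧ (∀ m ∈ R.measurements, twoQubitCount m.circuit ≤ n) ∧
      R.CorrectsOn Q {u | weight u ≤ t} := by
  subst hK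
  choose m hm hcost using fun i : Fin r => exists_linear_measurement hG (Pi.single i 1)
  refine exists_recovery_of_detects (Q := Q) (fun m => twoQubitCount m.circuit ≤ n) r
    {u | weight u ≤ t} m (fun i u => syndrome hG u i + syndrome hG (τ 0) i)
    (fun i => (hcost i).le) ?_ ?_
  · intro i u _ ψ hψ
    rw [hm]
    refine hQ.syndromeObservable_mulVec_pauliOp _ (fun j => ?_) hψ
    rw [Subsingleton.elim j 0, single_one_dotProduct, Pi.add_apply]
  · intro u hu u' hu' h
    exact (hQ.sameAction_of_syndrome hu hu' (i := 0) (j := 0) (funext h)).1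

lemma exists_recovery (ht : 1 ≤ t) (htn : t ≤ n) (hn : 2 ≤ n) (hr : r ≤ n) :
    ∃ R : Recovery n, R.depth + 1 ≤ n.choose t + 2 * t ∧
      (∀ m ∈ R.measurements, twoQubitCount m.circuit ≤ 2 * K * (n + 1) * (r - 1)) ∧
      R.CorrectsOn Q {u | weight u ≤ t} := by
  obtain ⟨⟨j, hj⟩, _⟩ := hQ.exists_index
  rcases eq_or_ne K 1 with hK | hK
  · obtain ⟨R, hR, hcost, hRc⟩ := hQ.exists_recovery_of_eq_one hK
    have h1 := succ_le_choose_add ht htn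
    have h2 := hQ.two_le_generators ht hn
    refine ⟨R, by omega, fun m hm => (hcost m hm).trans ?_, hRc⟩
    obtain ⟨m, rfl⟩ : ∃ m, r = m + 2 := ⟨r - 2, by omega⟩
    subst hK
    have : m + 2 - 1 = m + 1 := rfl
    rw [this]
    nlinarith
  · have hne : (Finset.powersetCard t (Finset.univ : Finset (Fin n))).toList ≠ [] := by
      rw [Ne, Finset.toList_eq_nil, Finset.powersetCard_eq_empty]
      simpa using htn
    obtain ⟨R, hR, hcost, hRc⟩ := hQ.exists_list_recovery (by omega) ht hr _ hne
      (fun A hA => by simpa using hA)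
    refine ⟨R, ?_, hcost, hRc.of_sameAction fun u hu => ?_⟩
    · rwa [Finset.length_toList, Finset.card_powersetCard, Finset.card_univ,
        Fintype.card_fin] at hR
    · obtain ⟨A, hA, hAu⟩ := exists_supportedOn htn hu
      exact ⟨u, ⟨hu, A, by simpa using hA, u, hAu, SameAction.refl _ _⟩, SameAction.refl _ _⟩

end IsShiftedCode

lemma Recovery.CorrectsOn.corrects {R : Recovery n} {Q : Submodule ℂ (Vec (Fin n))}
    (h : R.CorrectsOn Q {u | weight u ≤ t}) : R.Corrects t Q := by
  rintro E ⟨m, u, hu, rfl⟩ B hB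
  obtain ⟨c, hc⟩ := h u hu B hB
  refine ⟨Complex.I ^ (m : ℕ) * c, fun ψ hψ => ?_⟩
  rw [Matrix.smul_mulVec, Matrix.mulVec_smul, hc ψ hψ, smul_smul]

end Recovery

lemma weight_le {n : ℕ} (u : Fin n → Pauli) : weight u ≤ n :=
  (Finset.card_filter_le _ _).trans (by simp)

/-- No measurement is needed if the code is zero or if only the identity has to be corrected. -/
lemma exists_trivial_recovery {n t : ℕ} {Q : Submodule ℂ (Vec (Fin n))}
    (h : Q = ⊥ ∨ t = 0 ∨ n = 0) :
    ∃ R : Recovery n, R.depth = 0 ∧ R.measurements = [] ∧ R.Corrects t Q := by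
  have hsame : ∀ u ∈ {u | weight u ≤ t}, ∀ u' ∈ {u | weight u ≤ t}, SameAction Q u u' := by
    intro u hu u' hu'
    rcases h with rfl | h
    · refine ⟨1, fun ψ hψ => ?_⟩
      rw [(Submodule.mem_bot ℂ).1 hψ, Matrix.mulVec_zero, Matrix.mulVec_zero, smul_zero]
    · have key : ∀ v : Fin n → Pauli, weight v ≤ t → v = fun _ => Pauli.I := by
        intro v hv
        have h0 : weight v = 0 := by have := weight_le v; omega
        funext q
        by_contra hq
        exact absurd (Finset.mem_filter.2 ⟨Finset.mem_univ q, hq⟩)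
          (by rw [Finset.card_eq_zero.1 h0]; exact Finset.notMem_empty q)
      rw [key u hu, key u' hu']
      exact SameAction.refl _ _
  obtain ⟨p, hp⟩ := Recovery.exists_correct hsame
  exact ⟨.correct p, rfl, rfl, hp.corrects⟩

end QECC

theorem theorem4 (n k K t : ℕ) (C : QECC.UStCode n k K)
    (hC : QECC.IsErrorCorrecting t C.space) (hn : n = 1 → t = 0) :
    ∃ r : QECC.Recovery n,
      (r.depth : ℤ) ≤ (n.choose t : ℤ) + 2 * t - 1 ∧
      (∀ m ∈ r.measurements,
        (QECC.twoQubitCount m.circuit : ℤ) ≤ 2 * K * (n + 1) * ((n : ℤ) - k - 1)) ∧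
      r.Corrects t C.space := by
  by_cases htriv : C.space = ⊥ ∨ t = 0 ∨ n = 0
  · obtain ⟨R, hdepth, hmeas, hR⟩ := QECC.exists_trivial_recovery htriv
    refine ⟨R, ?_, fun m hm => by simp [hmeas] at hm, hR⟩
    rw [hdepth]
    rcases Nat.eq_zero_or_pos t with rfl | ht
    · simp
    · have : (0 : ℤ) ≤ n.choose t := Int.natCast_nonneg _
      push_cast
      omega
  · push Not at htriv
    obtain ⟨hQ, ht, hn0⟩ := htriv
    obtain ⟨τ, hspace, hinj⟩ := C.exists_strings
    -- All weights are at most `n`, so for `t > n` the procedure for `t = n` applies.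
    have hsub : QECC.pauliErrors n (min t n) ⊆ QECC.pauliErrors n t := by
      rintro E ⟨m, u, hu, rfl⟩
      exact ⟨m, u, hu.trans (min_le_left _ _), rfl⟩
    have hcode : QECC.IsShiftedCode C.isStabilizerGenerators (min t n) τ C.space :=
      ⟨hspace, hinj, fun E₁ h₁ E₂ h₂ => hC E₁ (hsub h₁) E₂ (hsub h₂), hQ⟩
    have hn2 : 2 ≤ n := by
      rcases eq_or_ne n 1 with h | h
      · exact absurd (hn h) ht
      · omega
    obtain ⟨R, hdepth, hcost, hR⟩ := hcode.exists_recovery (by omega) (min_le_right _ _) hn2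
      (Nat.sub_le n k)
    refine ⟨R, ?_, fun m hm => ?_, QECC.Recovery.CorrectsOn.corrects fun u hu =>
      hR u (le_min hu (QECC.weight_le u))⟩
    · rcases le_or_gt t n with h | h
      · rw [min_eq_left h] at hdepth
        omega
      · rw [min_eq_right h.le, Nat.choose_self] at hdepth
        omega
    · have h := hcost m hm
      have hk := C.k_le_n
      rcases Nat.eq_zero_or_pos (n - k) with h0 | h0
      · exfalso
        have := hcode.two_le_generators (by omega) hn2
        omega
      · have e : ((n - k - 1 : ℕ) : ℤ) = (n : ℤ) - k - 1 := by omega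
        rw [← e]
        exact_mod_cast h
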